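/- Let $n\ge 0$ be an integer and let $\sigma=(\sigma_{ij})$ be a symmetric complex $n\times n$ matrix. On $\mathbb{C}^{4n}=\mathbb{R}^{8n}$ with coordinates $z^1,\dots,z^{4n}$ put $\sigma(z)=\sum_{i,j=1}^n\sigma_{ij}z^iz^{j+n}$ and consider the real-valued function $$f(z)=\sum_{a=1}^{2n}\bigl(z^a\,\overline{z}^{\,a+2n}+\overline{z}^{\,a}z^{a+2n}\bigr)+|\sigma(z)|^2 .$$ Let $g=\sum_{A,B=1}^{4n}h_{AB}\,dz^A\cdot d\overline{z}^B$, $h_{AB}=\dfrac{\partial^2 f}{\partial z^A\partial\overline{z}^B}$, be the Kähler metric with potential $f$, where $dz^A\cdot d\overline z^B=\frac12(dz^A\otimes d\overline z^B+d\overline z^B\otimes dz^A)$. Then: 1. $g$ is a pseudo-Kähler metric (smooth, non-degenerate, invariant under the standard complex structure $J$, with closed Kähler form $g(J\cdot,\cdot)$) of neutral signature $(4n,4n)$. 2. $g$ is locally symmetric, i.e. its Riemann curvature tensor $R$ satisfies $\nabla R=0$, and $g$ is Ricci-flat. 3. $(\mathbb{R}^{8n},g)$ is geodesically complete and is a symmetric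 space: for every point $p$ there is an involutive isometry of $(\mathbb{R}^{8n},g)$ that fixes $p$ and has differential $-\mathrm{Id}$ at $p$. Moreover $(\mathbb{C}^{4n},g)$ is a Hermitian symmetric space: these isometries can be chosen holomorphic. 4. If $\sigma\neq0$, then $g$ is not flat, and not conformally flat, i.e. its Weyl tensor does not vanish identically. 5. If $\det\sigma\neq0$, then $(\mathbb{R}^{8n},g)$ is indecomposable: no non-empty open subset of it is isometric to a product of two semi-Riemannian manifolds of positive dimension. Moreover, at every point $p$, the (real) tangent space at $p$ is not the direct sum of two non-zero complementary subspaces that are non-degenerate for $g_p$ and invariant under the holonomy algebra $\mathfrak{hol}_p$. With respect to the identification $T_p\mathbb{C}^{4n}\cong\mathbb{C}^{4n}$ given by the coordinates, $\mathfrak{hol}_p$ (the Lie algebra of the holonomy group of $g$ at $p$) is exactly the set of all matrices $$\begin{pmatrix}0&0\\ B&0\end{pmatrix},\qquad B\in\mathbb{C}^{2n\times 2n}\ \text{skew-Hermitian}.$$ -/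

import Mathlib

set_option maxSynthPendingDepth 3

open scoped ContDiff Matrix ComplexConjugate

noncomputable section

namespace SemiRiem

/-! ### Semi-Riemannian geometry in a global linear chart

`E` is a finite-dimensional real vector space, regarded as a manifold with a single global chart;
the tangent space at every point is `E`. A field of bilinear forms on it is a map
`g : E → E →L[ℝ] E →L[ℝ] ℝ`. -/

section General

variable {E : Type*} [NormedAddCommGroup E] [NormedSpace ℝ E]

/-- `g` is a smooth semi-Riemannian metric on the set `U` (used for open `U`). -/
structure IsMetricOn (g : E → E →L[ℝ] E →L[ℝ] ℝ) (U : Set E) : Prop where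
  smooth : ContDiffOn ℝ ∞ g U
  symm : ∀ p ∈ U, ∀ v w, g p v w = g p w v
  nondegenerate : ∀ p ∈ U, ∀ v, (∀ w, g p v w = 0) → v = 0

/-- `g` is a smooth semi-Riemannian metric on all of `E`. -/
def IsMetric (g : E → E →L[ℝ] E →L[ℝ] ℝ) : Prop := IsMetricOn g Set.univ

/-- The quadratic form `v ↦ g p v v` on the tangent space at `p`. -/
def quadForm (g : E → E →L[ℝ] E →L[ℝ] ℝ) (p : E) : QuadraticForm ℝ E :=
  LinearMap.BilinMap.toQuadraticMap
    (LinearMap.mk₂ ℝ (fun v w => g p v w) (by simp) (by simp) (by simp) (by simp))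

theorem quadForm_apply (g : E → E →L[ℝ] E →L[ℝ] ℝ) (p v : E) :
    quadForm g p v = g p v v := rfl

/-- `g` has signature `(r, s)` (`r` plus signs and `s` minus signs) at every point. -/
def HasSignature (g : E → E →L[ℝ] E →L[ℝ] ℝ) (r s : ℕ) : Prop :=
  ∀ p, sigPos (quadForm g p) = r ∧ sigNeg (quadForm g p) = s

/-- The right-hand side of the Koszul formula for constant vector fields `X`, `Y`, `Z`,
see `koszul_apply`. -/
def koszul (g : E → E →L[ℝ] E →L[ℝ] ℝ) (p : E) : E →L[ℝ] E →L[ℝ] E →L[ℝ] ℝ :=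
  let flip₂ : (E →L[ℝ] E →L[ℝ] ℝ) →L[ℝ] E →L[ℝ] E →L[ℝ] ℝ :=
    (ContinuousLinearMap.flipₗᵢ ℝ E E ℝ).toContinuousLinearEquiv
  let rot : E →L[ℝ] E →L[ℝ] E →L[ℝ] ℝ := flip₂.comp (fderiv ℝ g p).flip
  (1 / 2 : ℝ) • (fderiv ℝ g p + (fderiv ℝ g p).flip - rot)

theorem koszul_apply (g : E → E →L[ℝ] E →L[ℝ] ℝ) (p X Y Z : E) :
    koszul g p X Y Z =
      1 / 2 * (fderiv ℝ g p X Y Z + fderiv ℝ g p Y X Z - fderiv ℝ g p Z X Y) := rfl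

/-- The Christoffel symbols of the Levi-Civita connection in the linear chart:
`christoffel g p X Y = Γ_p(X, Y) = (∇_X Y)(p)` for constant vector fields `X`, `Y`. It is the
vector with `g p (Γ_p(X, Y)) Z = koszul g p X Y Z`, obtained by raising an index with the inverse
of `g p : E → E*` (which exists if `g p` is non-degenerate and `E` is finite-dimensional). -/
def christoffel (g : E → E →L[ℝ] E →L[ℝ] ℝ) (p : E) : E →L[ℝ] E →L[ℝ] E :=
  (ContinuousLinearMap.compL ℝ E (E →L[ℝ] ℝ) E (g p).inverse) ∘L (koszul g p)

theorem christoffel_apply (g : E → E →L[ℝ] E →L[ℝ] ℝ) (p X Y : E) :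
    christoffel g p X Y = (g p).inverse (koszul g p X Y) := rfl

/-- The Christoffel symbols are characterised by the Koszul formula. -/
theorem metric_christoffel [FiniteDimensional ℝ E] {g : E → E →L[ℝ] E →L[ℝ] ℝ}
    (hg : IsMetric g) (p X Y Z : E) :
    g p (christoffel g p X Y) Z = koszul g p X Y Z := by
  have hinj : Function.Injective (g p : E →ₗ[ℝ] (E →L[ℝ] ℝ)) := by
    refine (injective_iff_map_eq_zero (g p : E →ₗ[ℝ] (E →L[ℝ] ℝ))).2 fun v hv => ?_
    refine hg.nondegenerate p (Set.mem_univ p) v fun w => ?_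
    have h2 : g p v = 0 := hv
    simp [h2]
  have hdim : Module.finrank ℝ E = Module.finrank ℝ (E →L[ℝ] ℝ) := by
    rw [← Subspace.dual_finrank_eq (K := ℝ) (V := E)]
    exact LinearEquiv.finrank_eq (LinearMap.toContinuousLinearMap (𝕜 := ℝ) (E := E) (F' := ℝ))
  let e := (LinearEquiv.ofInjectiveOfFinrankEq _ hinj hdim).toContinuousLinearEquiv
  have he : (e : E →L[ℝ] (E →L[ℝ] ℝ)) = g p := by
    ext v w
    rfl
  rw [christoffel_apply, ← he, ContinuousLinearMap.inverse_equiv]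
  simp

/-- The Riemann curvature tensor `R_p(X, Y) Z` with the convention
`R(X, Y) = [∇_X, ∇_Y] - ∇_[X, Y]`, see `curvature_apply`. -/
def curvature (g : E → E →L[ℝ] E →L[ℝ] ℝ) (p : E) : E →L[ℝ] E →L[ℝ] E →L[ℝ] E :=
  let Γ := christoffel g p
  let dΓ := fderiv ℝ (christoffel g) p
  let ΓΓ : E →L[ℝ] E →L[ℝ] E →L[ℝ] E :=
    (ContinuousLinearMap.compL ℝ E (E →L[ℝ] E) (E →L[ℝ] E)).flip Γ
      ∘L (ContinuousLinearMap.compL ℝ E E E) ∘L Γ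
  dΓ - dΓ.flip + ΓΓ - ΓΓ.flip

theorem curvature_apply (g : E → E →L[ℝ] E →L[ℝ] ℝ) (p X Y Z : E) :
    curvature g p X Y Z =
      fderiv ℝ (christoffel g) p X Y Z - fderiv ℝ (christoffel g) p Y X Z
        + christoffel g p X (christoffel g p Y Z) - christoffel g p Y (christoffel g p X Z) :=
  rfl

/-- `g` is flat: its curvature tensor vanishes. -/
def IsFlat (g : E → E →L[ℝ] E →L[ℝ] ℝ) : Prop := ∀ p, curvature g p = 0

/-- `(∇_W R)(X, Y) Z` at the point `p`. -/
def covDerivCurvature (g : E → E →L[ℝ] E →L[ℝ] ℝ) (p W X Y Z : E) : E :=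
  fderiv ℝ (curvature g) p W X Y Z
    + christoffel g p W (curvature g p X Y Z)
    - curvature g p (christoffel g p W X) Y Z
    - curvature g p X (christoffel g p W Y) Z
    - curvature g p X Y (christoffel g p W Z)

/-- `g` is locally symmetric: `∇R = 0`. -/
def IsLocallySymmetric (g : E → E →L[ℝ] E →L[ℝ] ℝ) : Prop :=
  ∀ p W X Y Z, covDerivCurvature g p W X Y Z = 0

/-- The Ricci tensor `Ric(Y, Z) = tr (X ↦ R(X, Y) Z)`. -/
def ricci (g : E → E →L[ℝ] E →L[ℝ] ℝ) (p Y Z : E) : ℝ :=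
  LinearMap.trace ℝ E (((curvature g p).flip Y).flip Z : E →L[ℝ] E)

/-- The endomorphism of which the Ricci tensor is the trace is `X ↦ R(X, Y) Z`. -/
theorem ricci_endomorphism_apply (g : E → E →L[ℝ] E →L[ℝ] ℝ) (p X Y Z : E) :
    ((curvature g p).flip Y).flip Z X = curvature g p X Y Z := rfl

/-- `g` is Ricci-flat. -/
def IsRicciFlat (g : E → E →L[ℝ] E →L[ℝ] ℝ) : Prop := ∀ p Y Z, ricci g p Y Z = 0

/-- `γ` is a geodesic defined on all of `ℝ`: `γ'' + Γ(γ', γ') = 0`. -/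
def IsGeodesic (g : E → E →L[ℝ] E →L[ℝ] ℝ) (γ : ℝ → E) : Prop :=
  ContDiff ℝ ∞ γ ∧
    ∀ t, deriv (deriv γ) t + christoffel g (γ t) (deriv γ t) (deriv γ t) = 0

/-- Geodesic completeness: every initial condition is that of a geodesic defined on `ℝ`. -/
def IsGeodesicallyComplete (g : E → E →L[ℝ] E →L[ℝ] ℝ) : Prop :=
  ∀ p v, ∃ γ : ℝ → E, IsGeodesic g γ ∧ γ 0 = p ∧ deriv γ 0 = v

/-- `s` is the geodesic symmetry at `p`: an involutive smooth isometry of `(E, g)` that fixes `p`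
and whose differential at `p` is `-1`. -/
structure IsSymmetryAt (g : E → E →L[ℝ] E →L[ℝ] ℝ) (p : E) (s : E → E) : Prop where
  smooth : ContDiff ℝ ∞ s
  involutive : Function.Involutive s
  isometry : ∀ q v w, g (s q) (fderiv ℝ s q v) (fderiv ℝ s q w) = g q v w
  fixes : s p = p
  differential : ∀ v, fderiv ℝ s p v = -v

/-- `(E, g)` is a (globally) symmetric space. -/
def IsSymmetricSpace (g : E → E →L[ℝ] E →L[ℝ] ℝ) : Prop :=
  ∀ p, ∃ s : E → E, IsSymmetryAt g p s

/-- `V` is a parallel vector field along the curve `γ`: `V' + Γ(γ', V) = 0`. -/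
def IsParallelAlong (g : E → E →L[ℝ] E →L[ℝ] ℝ) (γ V : ℝ → E) : Prop :=
  ∀ t, HasDerivAt V (-christoffel g (γ t) (deriv γ t) (V t)) t

/-- `T` is the parallel transport from the tangent space at `p` to that at `q` along some
piecewise smooth curve from `p` to `q`, that is, along a finite concatenation of smooth curves,
each parametrised by `[0, 1]`. -/
inductive IsParallelTransport (g : E → E →L[ℝ] E →L[ℝ] ℝ) : E → E → (E →L[ℝ] E) → Prop
  | const (p : E) : IsParallelTransport g p p (ContinuousLinearMap.id ℝ E)
  | append {p : E} {T : E →L[ℝ] E} (γ : ℝ → E) (S : E →L[ℝ] E)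
      (hT : IsParallelTransport g p (γ 0) T)
      (hγ : ContDiff ℝ ∞ γ)
      (hS : ∀ v, ∃ V : ℝ → E, IsParallelAlong g γ V ∧ V 0 = v ∧ V 1 = S v) :
      IsParallelTransport g p (γ 1) (S ∘L T)

/-- The holonomy group at `p`: all parallel transports along piecewise smooth loops at `p`. -/
def holonomyGroup (g : E → E →L[ℝ] E →L[ℝ] ℝ) (p : E) : Set (E →L[ℝ] E) :=
  {T | IsParallelTransport g p p T}

/-- The holonomy algebra at `p`: the Lie algebra of the holonomy group, that is, all generators
of one-parameter groups contained in the holonomy group. -/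
def holonomyAlgebra (g : E → E →L[ℝ] E →L[ℝ] ℝ) (p : E) : Set (E →L[ℝ] E) :=
  {A | ∀ t : ℝ, NormedSpace.exp (t • A) ∈ holonomyGroup g p}

/-- The holonomy algebra at `p` is indecomposable: the tangent space is not the sum of two
complementary proper subspaces that are invariant and non-degenerate. -/
def IsHolonomyIndecomposableAt (g : E → E →L[ℝ] E →L[ℝ] ℝ) (p : E) : Prop :=
  ¬ ∃ W : Fin 2 → Submodule ℝ E, IsCompl (W 0) (W 1) ∧ ∀ k,
    W k ≠ ⊥ ∧
    (∀ A ∈ holonomyAlgebra g p, ∀ v ∈ W k, A v ∈ W k) ∧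
    (∀ v ∈ W k, (∀ w ∈ W k, g p v w = 0) → v = 0)

/-- `(E, g)` splits locally as a product: some non-empty open subset `φ.source` is isometric,
through a diffeomorphism `φ`, to a product `(V₁ × V₂, g₁ ⊕ g₂)` of semi-Riemannian manifolds of
positive dimension. Shrinking the factors, `V₁` and `V₂` may be taken to be open subsets
of `ℝ ^ d₁` and `ℝ ^ d₂`. -/
def SplitsLocally (g : E → E →L[ℝ] E →L[ℝ] ℝ) : Prop :=
  ∃ (d₁ d₂ : ℕ) (V₁ : Set (Fin d₁ → ℝ)) (V₂ : Set (Fin d₂ → ℝ))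
    (g₁ : (Fin d₁ → ℝ) → (Fin d₁ → ℝ) →L[ℝ] (Fin d₁ → ℝ) →L[ℝ] ℝ)
    (g₂ : (Fin d₂ → ℝ) → (Fin d₂ → ℝ) →L[ℝ] (Fin d₂ → ℝ) →L[ℝ] ℝ)
    (φ : OpenPartialHomeomorph E ((Fin d₁ → ℝ) × (Fin d₂ → ℝ))),
    0 < d₁ ∧ 0 < d₂ ∧ IsOpen V₁ ∧ IsOpen V₂ ∧ IsMetricOn g₁ V₁ ∧ IsMetricOn g₂ V₂ ∧
    φ.source.Nonempty ∧ φ.target = V₁ ×ˢ V₂ ∧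
    ContDiffOn ℝ ∞ φ φ.source ∧ ContDiffOn ℝ ∞ φ.symm φ.target ∧
    ∀ p ∈ φ.source, ∀ v w, g p v w =
      g₁ (φ p).1 (fderiv ℝ φ p v).1 (fderiv ℝ φ p w).1
        + g₂ (φ p).2 (fderiv ℝ φ p v).2 (fderiv ℝ φ p w).2

/-- `(E, g)` is indecomposable: it does not split as a product, not even locally. -/
def IsIndecomposable (g : E → E →L[ℝ] E →L[ℝ] ℝ) : Prop := ¬ SplitsLocally g

end General

section Weyl

variable {E : Type*} [NormedAddCommGroup E] [NormedSpace ℝ E] [FiniteDimensional ℝ E]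

/-- The scalar curvature: the trace of the Ricci tensor with respect to `g`. -/
def scalarCurvature (g : E → E →L[ℝ] E →L[ℝ] ℝ) (p : E) : ℝ :=
  ∑ k, ricci g p (Module.finBasis ℝ E k)
    ((g p).inverse ((Module.finBasis ℝ E).coord k).toContinuousLinearMap)

/-- The Schouten tensor `P = (Ric - scal / (2 (m - 1)) g) / (m - 2)`, where `m = dim E`. -/
def schouten (g : E → E →L[ℝ] E →L[ℝ] ℝ) (p X Y : E) : ℝ :=
  (ricci g p X Y - scalarCurvature g p / (2 * ((Module.finrank ℝ E : ℝ) - 1)) * g p X Y)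
    / ((Module.finrank ℝ E : ℝ) - 2)

/-- The Weyl tensor `W(X, Y, Z, T)`, the totally trace-free part of `g(R(X, Y) Z, T)`. -/
def weyl (g : E → E →L[ℝ] E →L[ℝ] ℝ) (p X Y Z T : E) : ℝ :=
  g p (curvature g p X Y Z) T
    - (schouten g p Y Z * g p X T - schouten g p X Z * g p Y T
      + g p Y Z * schouten g p X T - g p X Z * schouten g p Y T)

/-- `g` is conformally flat, i.e. its Weyl tensor vanishes (used only in dimension `≥ 4`). -/
def IsConformallyFlat (g : E → E →L[ℝ] E →L[ℝ] ℝ) : Prop :=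
  ∀ p X Y Z T, weyl g p X Y Z T = 0

end Weyl

/-! ### Kähler metrics on `ℂ ^ ι` -/

section Kahler

variable {ι : Type*} [Fintype ι]

/-- `g` is a pseudo-Kähler metric for the standard complex structure `J = i` of `ℂ ^ ι`: it is
`J`-invariant and its Kähler form `ω = g(J ·, ·)` is closed. -/
structure IsPseudoKahler (g : (ι → ℂ) → (ι → ℂ) →L[ℝ] (ι → ℂ) →L[ℝ] ℝ) : Prop where
  isMetric : IsMetric g
  hermitian : ∀ p v w, g p (Complex.I • v) (Complex.I • w) = g p v w
  closed : ∀ p X Y Z, fderiv ℝ g p X (Complex.I • Y) Z + fderiv ℝ g p Y (Complex.I • Z) X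
    + fderiv ℝ g p Z (Complex.I • X) Y = 0

/-- `(ℂ ^ ι, g)` is a Hermitian symmetric space: `g` is a Hermitian semi-Riemannian metric and the
geodesic symmetry at every point exists and is holomorphic. -/
structure IsHermitianSymmetricSpace (g : (ι → ℂ) → (ι → ℂ) →L[ℝ] (ι → ℂ) →L[ℝ] ℝ) : Prop where
  isMetric : IsMetric g
  hermitian : ∀ p v w, g p (Complex.I • v) (Complex.I • w) = g p v w
  symmetry : ∀ p, ∃ s : (ι → ℂ) → (ι → ℂ), IsSymmetryAt g p s ∧ Differentiable ℂ s

variable [DecidableEq ι]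

/-- The Wirtinger derivative `∂F/∂z^A`. -/
def wirtinger (A : ι) (F : (ι → ℂ) → ℂ) (z : ι → ℂ) : ℂ :=
  (1 / 2) * (fderiv ℝ F z (Pi.single A 1) - Complex.I * fderiv ℝ F z (Pi.single A Complex.I))

/-- The Wirtinger derivative `∂F/∂z̄^A`. -/
def wirtingerBar (A : ι) (F : (ι → ℂ) → ℂ) (z : ι → ℂ) : ℂ :=
  (1 / 2) * (fderiv ℝ F z (Pi.single A 1) + Complex.I * fderiv ℝ F z (Pi.single A Complex.I))

/-- `h_{AB} = ∂²f / ∂z^A ∂z̄^B`. -/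
def complexHessian (f : (ι → ℂ) → ℝ) (z : ι → ℂ) (A B : ι) : ℂ :=
  wirtinger A (wirtingerBar B (fun y => (f y : ℂ))) z

/-- The Kähler metric `g = h_{AB} dz^A · dz̄^B` with potential `f`, where `·` is the symmetric
product: `dz^A · dz̄^B = (dz^A ⊗ dz̄^B + dz̄^B ⊗ dz^A) / 2`. Since `f` is real, this form is real;
taking the real part only records that. -/
def kahlerMetric (f : (ι → ℂ) → ℝ) (z : ι → ℂ) : (ι → ℂ) →L[ℝ] (ι → ℂ) →L[ℝ] ℝ :=
  (LinearMap.mk₂ ℝ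
    (fun v w : ι → ℂ => ∑ A, ∑ B,
      (complexHessian f z A B * ((v A * conj (w B) + w A * conj (v B)) / 2)).re)
    (fun v v' w => by
      simp only [← Finset.sum_add_distrib, ← Complex.add_re, Pi.add_apply, map_add]
      refine Finset.sum_congr rfl fun A _ => Finset.sum_congr rfl fun B _ => ?_
      congr 1; ring)
    (fun c v w => by
      simp only [smul_eq_mul, Finset.mul_sum, ← Complex.re_ofReal_mul, Pi.smul_apply,
        Complex.real_smul, map_mul, Complex.conj_ofReal]
      refine Finset.sum_congr rfl fun A _ => Finset.sum_congr rfl fun B _ => ?_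
      congr 1; ring)
    (fun v w w' => by
      simp only [← Finset.sum_add_distrib, ← Complex.add_re, Pi.add_apply, map_add]
      refine Finset.sum_congr rfl fun A _ => Finset.sum_congr rfl fun B _ => ?_
      congr 1; ring)
    (fun c v w => by
      simp only [smul_eq_mul, Finset.mul_sum, ← Complex.re_ofReal_mul, Pi.smul_apply,
        Complex.real_smul, map_mul, Complex.conj_ofReal]
      refine Finset.sum_congr rfl fun A _ => Finset.sum_congr rfl fun B _ => ?_
      congr 1; ring)).toContinuousBilinearMap

theorem kahlerMetric_apply (f : (ι → ℂ) → ℝ) (z v w : ι → ℂ) :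
    kahlerMetric f z v w = ∑ A, ∑ B,
      (complexHessian f z A B * ((v A * conj (w B) + w A * conj (v B)) / 2)).re := rfl

end Kahler

/-! ### The metric of the theorem -/

/-- The index set `{1, …, 2n}`: `Sum.inl i` is the index `i`, `Sum.inr i` is the index `i + n`. -/
abbrev HalfIdx (n : ℕ) : Type := Fin n ⊕ Fin n

/-- The index set `{1, …, 4n}`: `Sum.inl a` is the index `a`, `Sum.inr a` is the index `a + 2n`. -/
abbrev Idx (n : ℕ) : Type := HalfIdx n ⊕ HalfIdx n

/-- The quadratic polynomial `σ(z) = ∑ σ_{ij} z^i z^{j+n}`. -/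
def sigmaPoly {n : ℕ} (σ : Matrix (Fin n) (Fin n) ℂ) (z : Idx n → ℂ) : ℂ :=
  ∑ i, ∑ j, σ i j * z (Sum.inl (Sum.inl i)) * z (Sum.inl (Sum.inr j))

/-- The potential
`f(z) = ∑_a (z^a z̄^{a+2n} + z̄^a z^{a+2n}) + |σ(z)|²`. -/
def potential {n : ℕ} (σ : Matrix (Fin n) (Fin n) ℂ) (z : Idx n → ℂ) : ℝ :=
  ∑ a, 2 * (z (Sum.inl a) * conj (z (Sum.inr a))).re + ‖sigmaPoly σ z‖ ^ 2

/-- The metric `g` on `ℂ ^ {4n}` with Kähler potential `potential σ`. -/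
def metric {n : ℕ} (σ : Matrix (Fin n) (Fin n) ℂ) :
    (Idx n → ℂ) → (Idx n → ℂ) →L[ℝ] (Idx n → ℂ) →L[ℝ] ℝ :=
  kahlerMetric (potential σ)

end SemiRiem

end

/-! Write a point as `(x, y)` with `x`, `y` in `ℂ^{2n}`, and let `M` be the block matrix with
off-diagonal blocks `σ`, `σᵀ`, so that `2 σ(z) = xᵀ M x`. The theorem depends on the potential only
through the symmetric form `H = horForm M`, which sees only horizontal parts `x`, and the antilinear
map `vertLift M`, `x ↦ (0, conj (M x))`, which takes vertical values. Since `σ(z)` is holomorphic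
with differential `H(z, ·)`, the metric is the real part of the pairing of the two halves plus `H(z,
v) conj H(z, w)` (`metric_eq`). Raising an index gives `Γ_p(X, Y) = H(X, Y) vertLift p` and `R(X, Y)
Z = H(Y, Z) vertLift X - H(X, Z) vertLift Y`. Because `H` and `vertLift` both kill vertical vectors,
all compositions of these tensors vanish. So `R` is constant and parallel, `X ↦ R(X, Y) Z` squares
to zero (Ricci-flatness, hence Weyl equals Riemann), geodesics are cubic polynomials, and the
geodesic symmetries are explicit quadratic holomorphic maps. Neutral signature follows from a linear
anti-isometry of each tangent space.

Holonomy: parallel transport fixes horizontal parts and preserves the Hermitian form, so around a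
loop it is `1 + B` with `B` skew-Hermitian from horizontal to vertical vectors
(`holonomyGroup_subset`). Conversely a circle in the complex line of `u` contributes an imaginary
multiple of the rank-one matrix `(M u)^* (M u)` (`append_circleLoop`). If `M` is invertible, these
circles and the spectral theorem produce every skew-Hermitian `B` (`mem_holonomyGroup`). Such `B`
can send two vectors with nonzero horizontal parts to the same nonzero vertical vector, which
excludes an invariant non-degenerate splitting.

Local products: a product has no mixed curvature `R(a', b) a` (`mixed_curvature_eq_zero`). For this
`R` the relation forces one factor to be tangent to vertical directions
(`horizontal_eq_zero_of_mixed`), which are totally isotropic, contradicting non-degeneracy of that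
factor. -/

noncomputable section

namespace SemiRiem

/-! ### The Hermitian form of the metric -/

variable {ι : Type*} [Fintype ι]

/-- The symmetric bilinear form `x ↦ xᵀ M v` in the first half of the coordinates. -/
def horForm (M : Matrix ι ι ℂ) : (ι ⊕ ι → ℂ) →ₗ[ℂ] (ι ⊕ ι → ℂ) →ₗ[ℂ] ℂ :=
  LinearMap.mk₂ ℂ (fun x v => (M *ᵥ fun a => x (Sum.inl a)) ⬝ᵥ fun a => v (Sum.inl a))
    (fun x y v => by
      have h : (fun a => (x + y) (Sum.inl a)) = (fun a => x (Sum.inl a)) + fun a => y (Sum.inl a) :=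
        rfl
      rw [h, Matrix.mulVec_add, add_dotProduct])
    (fun c x v => by
      have h : (fun a => (c • x) (Sum.inl a)) = c • (fun a => x (Sum.inl a)) := rfl
      rw [h, Matrix.mulVec_smul, smul_dotProduct])
    (fun x v w => by
      have h : (fun a => (v + w) (Sum.inl a)) = (fun a => v (Sum.inl a)) + fun a => w (Sum.inl a) :=
        rfl
      rw [h, dotProduct_add])
    (fun c x v => by
      have h : (fun a => (c • v) (Sum.inl a)) = c • (fun a => v (Sum.inl a)) := rfl
      rw [h, dotProduct_smul])

theorem horForm_apply (M : Matrix ι ι ℂ) (x v : ι ⊕ ι → ℂ) :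
    horForm M x v = (M *ᵥ fun a => x (Sum.inl a)) ⬝ᵥ fun a => v (Sum.inl a) := rfl

theorem horForm_real_smul_left (M : Matrix ι ι ℂ) (r : ℝ) (x v : ι ⊕ ι → ℂ) :
    horForm M (r • x) v = r * horForm M x v := by
  rw [LinearMap.map_smul_of_tower, LinearMap.smul_apply, Complex.real_smul]

theorem horForm_real_smul_right (M : Matrix ι ι ℂ) (r : ℝ) (x v : ι ⊕ ι → ℂ) :
    horForm M x (r • v) = r * horForm M x v := by
  rw [LinearMap.map_smul_of_tower, Complex.real_smul]

theorem horForm_comm {M : Matrix ι ι ℂ} (hM : Mᵀ = M) (x v : ι ⊕ ι → ℂ) :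
    horForm M x v = horForm M v x := by
  rw [horForm_apply, horForm_apply, dotProduct_comm, Matrix.dotProduct_mulVec,
    ← Matrix.mulVec_transpose, hM]

/-- The vertical vector `conj (M x)`. -/
def vertLift (M : Matrix ι ι ℂ) (x : ι ⊕ ι → ℂ) : ι ⊕ ι → ℂ :=
  Sum.elim 0 (star (M *ᵥ fun a => x (Sum.inl a)))

@[simp] theorem vertLift_inl (M : Matrix ι ι ℂ) (x : ι ⊕ ι → ℂ) (a : ι) :
    vertLift M x (Sum.inl a) = 0 := rfl

theorem vertLift_inr (M : Matrix ι ι ℂ) (x : ι ⊕ ι → ℂ) (a : ι) :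
    vertLift M x (Sum.inr a) = conj ((M *ᵥ fun a => x (Sum.inl a)) a) := rfl

theorem vertLift_add (M : Matrix ι ι ℂ) (x y : ι ⊕ ι → ℂ) :
    vertLift M (x + y) = vertLift M x + vertLift M y := by
  have h : (fun a => (x + y) (Sum.inl a)) = (fun a => x (Sum.inl a)) + fun a => y (Sum.inl a) :=
    rfl
  ext (a | a)
  · simp
  · rw [vertLift_inr, h, Matrix.mulVec_add, Pi.add_apply, map_add, Pi.add_apply, vertLift_inr,
      vertLift_inr]

theorem vertLift_smul (M : Matrix ι ι ℂ) (c : ℂ) (x : ι ⊕ ι → ℂ) :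
    vertLift M (c • x) = conj c • vertLift M x := by
  have h : (fun a => (c • x) (Sum.inl a)) = c • (fun a => x (Sum.inl a)) := rfl
  ext (a | a)
  · simp
  · rw [vertLift_inr, h, Matrix.mulVec_smul, Pi.smul_apply, smul_eq_mul, map_mul, Pi.smul_apply,
      vertLift_inr, smul_eq_mul]

theorem vertLift_real_smul (M : Matrix ι ι ℂ) (r : ℝ) (x : ι ⊕ ι → ℂ) :
    vertLift M (r • x) = r • vertLift M x := by
  have h := vertLift_smul M (r : ℂ) x
  rw [Complex.conj_ofReal] at h
  simpa using h

/-- The real-linear version of `vertLift`. -/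
def vertLiftL (M : Matrix ι ι ℂ) : (ι ⊕ ι → ℂ) →ₗ[ℝ] (ι ⊕ ι → ℂ) where
  toFun := vertLift M
  map_add' := vertLift_add M
  map_smul' := vertLift_real_smul M

theorem vertLiftL_apply (M : Matrix ι ι ℂ) (x : ι ⊕ ι → ℂ) : vertLiftL M x = vertLift M x := rfl

/-- A vertical vector has no first half. This and its companions make every product of Christoffel
symbols and curvatures vanish. -/
theorem horForm_vertLift_left (M N : Matrix ι ι ℂ) (x v : ι ⊕ ι → ℂ) :
    horForm M (vertLift N x) v = 0 := by
  have h : (fun a => vertLift N x (Sum.inl a)) = 0 := rfl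
  rw [horForm_apply, h, Matrix.mulVec_zero, zero_dotProduct]

theorem horForm_vertLift_right (M N : Matrix ι ι ℂ) (x v : ι ⊕ ι → ℂ) :
    horForm M v (vertLift N x) = 0 := by
  have h : (fun a => vertLift N x (Sum.inl a)) = 0 := rfl
  rw [horForm_apply, h, dotProduct_zero]

theorem vertLift_vertLift (M N : Matrix ι ι ℂ) (x : ι ⊕ ι → ℂ) :
    vertLift M (vertLift N x) = 0 := by
  have h : (fun a => vertLift N x (Sum.inl a)) = 0 := rfl
  rw [vertLift, h, Matrix.mulVec_zero]
  ext (a | a) <;> simp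

@[fun_prop] theorem contDiff_horForm (M : Matrix ι ι ℂ) {F : Type*} [NormedAddCommGroup F]
    [NormedSpace ℝ F] {f h : F → ι ⊕ ι → ℂ} {m : WithTop ℕ∞} (hf : ContDiff ℝ m f)
    (hh : ContDiff ℝ m h) : ContDiff ℝ m fun q => horForm M (f q) (h q) := by
  simp only [horForm_apply, Matrix.mulVec, dotProduct]
  fun_prop

theorem contDiff_vertLift (M : Matrix ι ι ℂ) {m : WithTop ℕ∞} : ContDiff ℝ m (vertLift M) :=
  (LinearMap.toContinuousLinearMap (vertLiftL M)).contDiff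

/-- The Hermitian pairing of the two halves of the coordinates. -/
def pairing (v w : ι ⊕ ι → ℂ) : ℂ :=
  ∑ a, (v (Sum.inl a) * conj (w (Sum.inr a)) + v (Sum.inr a) * conj (w (Sum.inl a)))

/-- The metric with Kähler potential `2 Re ⟨x, y⟩ + |xᵀ M x / 2|²`. -/
def quarticMetric (M : Matrix ι ι ℂ) (q v w : ι ⊕ ι → ℂ) : ℝ :=
  (pairing v w).re + (horForm M q v * conj (horForm M q w)).re

theorem pairing_add_left (u v w : ι ⊕ ι → ℂ) :
    pairing (u + v) w = pairing u w + pairing v w := by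
  simp only [pairing, ← Finset.sum_add_distrib, Pi.add_apply]
  exact Finset.sum_congr rfl fun a _ => by ring

theorem pairing_smul_left (c : ℂ) (v w : ι ⊕ ι → ℂ) : pairing (c • v) w = c * pairing v w := by
  simp only [pairing, Finset.mul_sum, Pi.smul_apply, smul_eq_mul]
  exact Finset.sum_congr rfl fun a _ => by ring

theorem pairing_comm (v w : ι ⊕ ι → ℂ) : pairing v w = conj (pairing w v) := by
  simp only [pairing, map_sum, map_add, map_mul, Complex.conj_conj]
  exact Finset.sum_congr rfl fun a _ => by ring

theorem pairing_add_right (u v w : ι ⊕ ι → ℂ) :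
    pairing u (v + w) = pairing u v + pairing u w := by
  rw [pairing_comm, pairing_add_left, map_add, ← pairing_comm, ← pairing_comm]

theorem pairing_smul_right (c : ℂ) (v w : ι ⊕ ι → ℂ) :
    pairing v (c • w) = conj c * pairing v w := by
  rw [pairing_comm, pairing_smul_left, map_mul, ← pairing_comm]

/-- `vertLift M x` represents the functional `conj H(x, ·)`; this is how indices are raised below
without inverting the metric. -/
theorem pairing_vertLift_left (M : Matrix ι ι ℂ) (x w : ι ⊕ ι → ℂ) :
    pairing (vertLift M x) w = conj (horForm M x w) := by
  simp [pairing, horForm_apply, vertLift_inr, dotProduct]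

theorem pairing_vertLift_right (M : Matrix ι ι ℂ) (x w : ι ⊕ ι → ℂ) :
    pairing w (vertLift M x) = horForm M x w := by
  rw [pairing_comm, pairing_vertLift_left, Complex.conj_conj]

theorem quarticMetric_comm (M : Matrix ι ι ℂ) (q v w : ι ⊕ ι → ℂ) :
    quarticMetric M q v w = quarticMetric M q w v := by
  rw [quarticMetric, quarticMetric, pairing_comm v w, Complex.conj_re]
  congr 1
  rw [← Complex.conj_re, map_mul, Complex.conj_conj, mul_comm]

theorem quarticMetric_I_smul (M : Matrix ι ι ℂ) (q v w : ι ⊕ ι → ℂ) :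
    quarticMetric M q (Complex.I • v) (Complex.I • w) = quarticMetric M q v w := by
  have h1 : pairing (Complex.I • v) (Complex.I • w) = pairing v w := by
    rw [pairing_smul_left, pairing_smul_right, ← mul_assoc, Complex.mul_conj]
    simp
  have h2 : horForm M q (Complex.I • v) * conj (horForm M q (Complex.I • w))
      = horForm M q v * conj (horForm M q w) := by
    simp only [map_smul, smul_eq_mul, map_mul, Complex.conj_I]
    linear_combination (-(horForm M q v * conj (horForm M q w))) * Complex.I_mul_I
  rw [quarticMetric, h1, h2, quarticMetric]

theorem quarticMetric_vert (M : Matrix ι ι ℂ) (q v w : ι ⊕ ι → ℂ)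
    (hv : ∀ a, v (Sum.inl a) = 0) :
    quarticMetric M q v w = (∑ a, v (Sum.inr a) * conj (w (Sum.inl a))).re := by
  have h : (fun a => v (Sum.inl a)) = 0 := funext hv
  rw [quarticMetric, horForm_apply, h, dotProduct_zero]
  simp [pairing, hv]

theorem quarticMetric_nondegenerate [DecidableEq ι] (M : Matrix ι ι ℂ) (q v : ι ⊕ ι → ℂ)
    (h : ∀ w, quarticMetric M q v w = 0) : v = 0 := by
  have hx : ∀ a, v (Sum.inl a) = 0 := by
    intro a
    -- Against a vertical test vector the quartic term drops out, and this one returns `|v (inl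
    -- a)|²`. Once `v` is known to be vertical, the same trick works with a horizontal test vector.
    have h1 := h (Pi.single (Sum.inr a) (v (Sum.inl a)))
    rw [quarticMetric_comm, quarticMetric_vert _ _ _ _ (by simp)] at h1
    rw [Finset.sum_eq_single a (fun b _ hb => by simp [hb]) (by simp)] at h1
    simpa [Complex.mul_conj] using h1
  ext (a | a)
  · exact hx a
  · have h1 := h (Pi.single (Sum.inl a) (v (Sum.inr a)))
    rw [quarticMetric_vert _ _ _ _ hx] at h1
    rw [Finset.sum_eq_single a (fun b _ hb => by simp [hb]) (by simp)] at h1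
    simpa [Complex.mul_conj] using h1

/-- The block matrix of the bilinear form `x ↦ 2 σ(x)`. -/
def sigmaMatrix {n : ℕ} (σ : Matrix (Fin n) (Fin n) ℂ) : Matrix (HalfIdx n) (HalfIdx n) ℂ :=
  Matrix.fromBlocks 0 σ σᵀ 0

theorem sigmaMatrix_transpose {n : ℕ} (σ : Matrix (Fin n) (Fin n) ℂ) :
    (sigmaMatrix σ)ᵀ = sigmaMatrix σ := by
  simp [sigmaMatrix, Matrix.fromBlocks_transpose]

theorem sigmaPoly_eq {n : ℕ} (σ : Matrix (Fin n) (Fin n) ℂ) (z : Idx n → ℂ) :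
    sigmaPoly σ z = (1 / 2) * horForm (sigmaMatrix σ) z z := by
  -- Each of the two off-diagonal blocks contributes one copy of `σ(z)`.
  have h : horForm (sigmaMatrix σ) z z = sigmaPoly σ z + sigmaPoly σ z := by
    simp only [horForm_apply, dotProduct, Matrix.mulVec, Fintype.sum_sum_type, sigmaMatrix,
      Matrix.fromBlocks_apply₁₁, Matrix.fromBlocks_apply₁₂, Matrix.fromBlocks_apply₂₁,
      Matrix.fromBlocks_apply₂₂, Matrix.zero_apply, zero_mul, Finset.sum_const_zero, zero_add,
      add_zero, Matrix.transpose_apply, sigmaPoly, Finset.sum_mul]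
    congr 1
    · refine Finset.sum_congr rfl fun i _ => Finset.sum_congr rfl fun j _ => by ring
    · rw [Finset.sum_comm]
  rw [h]; ring

end SemiRiem
end

noncomputable section

namespace SemiRiem

/-! ### The metric with the given Kähler potential -/

theorem fderiv_apply_eq_of_hasDerivAt {E F : Type*} [NormedAddCommGroup E] [NormedSpace ℝ E]
    [NormedAddCommGroup F] [NormedSpace ℝ F] {f : E → F} {p v : E} {d : F}
    (hf : DifferentiableAt ℝ f p) (hd : HasDerivAt (fun t : ℝ => f (p + t • v)) d 0) :
    fderiv ℝ f p v = d := by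
  rw [← hf.lineDeriv_eq_fderiv]
  exact HasLineDerivAt.lineDeriv hd

theorem single_I {κ : Type*} [DecidableEq κ] (A : κ) :
    (Pi.single A Complex.I : κ → ℂ) = Complex.I • Pi.single A 1 := by
  ext b
  by_cases h : b = A
  · subst h; simp
  · simp [h]

variable {ι : Type*} [Fintype ι]

theorem pairing_real_smul_left (r : ℝ) (v w : ι ⊕ ι → ℂ) :
    pairing (r • v) w = r * pairing v w :=
  pairing_smul_left (r : ℂ) v w

theorem pairing_real_smul_right (r : ℝ) (v w : ι ⊕ ι → ℂ) :
    pairing v (r • w) = r * pairing v w := by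
  have h := pairing_smul_right (r : ℂ) v w
  rwa [Complex.conj_ofReal] at h

@[fun_prop] theorem contDiff_pairing {F : Type*} [NormedAddCommGroup F]
    [NormedSpace ℝ F] {f h : F → ι ⊕ ι → ℂ} {m : WithTop ℕ∞} (hf : ContDiff ℝ m f)
    (hh : ContDiff ℝ m h) : ContDiff ℝ m fun q => pairing (f q) (h q) := by
  have hc : ∀ k : F → ℂ, ContDiff ℝ m k → ContDiff ℝ m fun q => conj (k q) := fun k hk =>
    Complex.conjCLE.contDiff.comp hk
  simp only [pairing]
  refine ContDiff.sum fun a _ => ?_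
  exact ((contDiff_pi.1 hf _).mul (hc _ (contDiff_pi.1 hh _))).add
    ((contDiff_pi.1 hf _).mul (hc _ (contDiff_pi.1 hh _)))

theorem contDiff_conj {F : Type*} [NormedAddCommGroup F]
    [NormedSpace ℝ F] {k : F → ℂ} {m : WithTop ℕ∞} (hk : ContDiff ℝ m k) :
    ContDiff ℝ m fun q => conj (k q) :=
  Complex.conjCLE.contDiff.comp hk

theorem hasDerivAt_conj {k : ℝ → ℂ} {d : ℂ} {t : ℝ} (hk : HasDerivAt k d t) :
    HasDerivAt (fun t => conj (k t)) (conj d) t :=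
  Complex.conjCLE.toContinuousLinearMap.hasFDerivAt.comp_hasDerivAt t hk

theorem hasDerivAt_line (v w : ℂ) : HasDerivAt (fun t : ℝ => v + t * w) w 0 := by
  simpa using ((Complex.ofRealCLM.hasDerivAt (x := (0 : ℝ))).mul_const w).const_add v

theorem hasDerivAt_quadratic (u v w : ℂ) :
    HasDerivAt (fun t : ℝ => u + t * v + t * t * w) v 0 := by
  have h0 := Complex.ofRealCLM.hasDerivAt (x := (0 : ℝ))
  have h1 := (hasDerivAt_line u v).add ((h0.mul h0).mul_const w)
  convert! h1 using 1
  simp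

theorem hasDerivAt_horForm_line {M : Matrix ι ι ℂ} (z v e : ι ⊕ ι → ℂ) :
    HasDerivAt (fun t : ℝ => horForm M (z + t • v) e) (horForm M v e) 0 := by
  simp only [map_add, LinearMap.add_apply, horForm_real_smul_left]
  exact hasDerivAt_line _ _

theorem hasDerivAt_halfHorForm_line {M : Matrix ι ι ℂ} (hM : Mᵀ = M) (z v : ι ⊕ ι → ℂ) :
    HasDerivAt (fun t : ℝ => (1 / 2) * horForm M (z + t • v) (z + t • v)) (horForm M z v) 0 := by
  convert! hasDerivAt_quadratic ((1 / 2) * horForm M z z) (horForm M z v)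
    ((1 / 2) * horForm M v v) using 1
  ext t
  simp only [map_add, LinearMap.add_apply, horForm_real_smul_left, horForm_real_smul_right]
  rw [horForm_comm hM v z]
  ring

theorem hasDerivAt_pairing_line (z v e : ι ⊕ ι → ℂ) :
    HasDerivAt (fun t : ℝ => pairing (z + t • v) e) (pairing v e) 0 := by
  simp only [pairing_add_left, pairing_real_smul_left]
  exact hasDerivAt_line _ _

theorem hasDerivAt_pairing_self_line (z v : ι ⊕ ι → ℂ) :
    HasDerivAt (fun t : ℝ => pairing (z + t • v) (z + t • v)) (pairing v z + pairing z v) 0 := by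
  convert! hasDerivAt_quadratic (pairing z z) (pairing v z + pairing z v) (pairing v v) using 1
  ext t
  simp only [pairing_add_left, pairing_add_right, pairing_real_smul_left, pairing_real_smul_right]
  ring

theorem potential_eq {n : ℕ} (σ : Matrix (Fin n) (Fin n) ℂ) (z : Idx n → ℂ) :
    (potential σ z : ℂ) = pairing z z +
      (1 / 2) * horForm (sigmaMatrix σ) z z * conj ((1 / 2) * horForm (sigmaMatrix σ) z z) := by
  rw [potential, sigmaPoly_eq, Complex.mul_conj, Complex.normSq_eq_norm_sq]
  push_cast
  congr 1
  refine Finset.sum_congr rfl fun a _ => ?_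
  have h := Complex.add_conj (z (Sum.inl a) * conj (z (Sum.inr a)))
  rw [map_mul, Complex.conj_conj] at h
  push_cast at h
  rw [← h]; ring

/-- The Hermitian form of which `quarticMetric M z` is the real part. -/
def hermForm (M : Matrix ι ι ℂ) (z : ι ⊕ ι → ℂ) :
    (ι ⊕ ι → ℂ) →ₗ[ℂ] (ι ⊕ ι → ℂ) →ₗ⋆[ℂ] ℂ :=
  LinearMap.mk₂'ₛₗ (RingHom.id ℂ) (starRingEnd ℂ)
    (fun v w => pairing v w + horForm M z v * conj (horForm M z w))
    (fun v v' w => by rw [pairing_add_left, map_add]; ring)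
    (fun c v w => by
      simp only [pairing_smul_left, map_smul, smul_eq_mul, RingHom.id_apply]; ring)
    (fun v w w' => by rw [pairing_add_right, map_add, map_add]; ring)
    (fun c v w => by
      simp only [pairing_smul_right, map_smul, smul_eq_mul, map_mul]; ring)

theorem hermForm_apply (M : Matrix ι ι ℂ) (z v w : ι ⊕ ι → ℂ) :
    hermForm M z v w = pairing v w + horForm M z v * conj (horForm M z w) := rfl

theorem re_hermForm (M : Matrix ι ι ℂ) (z v w : ι ⊕ ι → ℂ) :
    (hermForm M z v w).re = quarticMetric M z v w := by
  rw [hermForm_apply, quarticMetric, Complex.add_re]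

variable [DecidableEq ι]

/-- `H(z, z) / 2` is holomorphic, so `∂/∂z̄` only differentiates its conjugate, and picks the
antilinear part of the real derivative. -/
theorem wirtingerBar_potential {M : Matrix ι ι ℂ} (hM : Mᵀ = M) (B : ι ⊕ ι) (z : ι ⊕ ι → ℂ) :
    wirtingerBar B (fun z => pairing z z +
      (1 / 2) * horForm M z z * conj ((1 / 2) * horForm M z z)) z =
    pairing z (Pi.single B 1) + (1 / 2) * horForm M z z * conj (horForm M z (Pi.single B 1)) := by
  have key : ∀ v, fderiv ℝ (fun z => pairing z z +
      (1 / 2) * horForm M z z * conj ((1 / 2) * horForm M z z)) z v =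
      (pairing v z + pairing z v) + (horForm M z v * conj ((1 / 2) * horForm M z z) +
        (1 / 2) * horForm M z z * conj (horForm M z v)) := by
    intro v
    have hs : ContDiff ℝ 1 fun z : ι ⊕ ι → ℂ => (1 / 2) * horForm M z z :=
      contDiff_const.mul (contDiff_horForm M contDiff_id contDiff_id)
    refine fderiv_apply_eq_of_hasDerivAt ?_ ?_
    · exact ((((contDiff_pairing contDiff_id contDiff_id).add
        (hs.mul (contDiff_conj hs))).contDiffAt).differentiableAt (by norm_num))
    · have h1 := hasDerivAt_halfHorForm_line hM z v
      have h2 := (hasDerivAt_pairing_self_line z v).add (h1.mul (hasDerivAt_conj h1))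
      convert! h2 using 1
      simp only [zero_smul, add_zero]
  rw [wirtingerBar, key, key, single_I]
  simp only [pairing_smul_left, pairing_smul_right, map_smul, smul_eq_mul, map_mul,
    Complex.conj_I]
  ring_nf
  simp only [Complex.I_sq]
  ring

theorem wirtinger_wirtingerBar_potential {M : Matrix ι ι ℂ} (hM : Mᵀ = M) (A B : ι ⊕ ι)
    (z : ι ⊕ ι → ℂ) :
    wirtinger A (wirtingerBar B (fun z => pairing z z +
      (1 / 2) * horForm M z z * conj ((1 / 2) * horForm M z z))) z =
    pairing (Pi.single A 1) (Pi.single B 1) +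
      horForm M z (Pi.single A 1) * conj (horForm M z (Pi.single B 1)) := by
  have h0 := funext (wirtingerBar_potential hM B)
  set e : ι ⊕ ι → ℂ := Pi.single B 1
  have key : ∀ v, fderiv ℝ (fun z => pairing z e +
      (1 / 2) * horForm M z z * conj (horForm M z e)) z v =
      pairing v e + (horForm M z v * conj (horForm M z e) +
        (1 / 2) * horForm M z z * conj (horForm M v e)) := by
    intro v
    have hs : ContDiff ℝ 1 fun z : ι ⊕ ι → ℂ => (1 / 2) * horForm M z z :=
      contDiff_const.mul (contDiff_horForm M contDiff_id contDiff_id)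
    refine fderiv_apply_eq_of_hasDerivAt ?_ ?_
    · exact ((((contDiff_pairing contDiff_id contDiff_const).add
        (hs.mul (contDiff_conj (contDiff_horForm M contDiff_id
          contDiff_const)))).contDiffAt).differentiableAt (by norm_num))
    · have h2 := (hasDerivAt_pairing_line z v e).add ((hasDerivAt_halfHorForm_line hM z v).mul
        (hasDerivAt_conj (hasDerivAt_horForm_line (M := M) z v e)))
      convert! h2 using 1
      simp only [zero_smul, add_zero]
  rw [h0, wirtinger, key, key, single_I]
  simp only [pairing_smul_left, map_smul, LinearMap.smul_apply, smul_eq_mul, map_mul,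
    Complex.conj_I]
  ring_nf
  simp only [Complex.I_sq]
  ring

theorem sum_hermForm (M : Matrix ι ι ℂ) (z v w : ι ⊕ ι → ℂ) :
    ∑ A, ∑ B, hermForm M z (Pi.single A 1) (Pi.single B 1) * (v A * conj (w B)) =
      hermForm M z v w := by
  have hv : v = ∑ A, v A • Pi.single A 1 := by
    ext b; simp [Finset.sum_apply, Pi.single_apply]
  have hw : w = ∑ A, w A • Pi.single A 1 := by
    ext b; simp [Finset.sum_apply, Pi.single_apply]
  conv_rhs => rw [hv, hw]
  simp only [map_sum, LinearMap.sum_apply, map_smul, LinearMap.smul_apply, LinearMap.map_smulₛₗ,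
    smul_eq_mul, Finset.mul_sum]
  rw [Finset.sum_comm]
  exact Finset.sum_congr rfl fun A _ => Finset.sum_congr rfl fun B _ => by ring

theorem metric_eq {n : ℕ} (σ : Matrix (Fin n) (Fin n) ℂ) (z v w : Idx n → ℂ) :
    metric σ z v w = quarticMetric (sigmaMatrix σ) z v w := by
  have hf : (fun y => (potential σ y : ℂ)) = fun z => pairing z z +
      (1 / 2) * horForm (sigmaMatrix σ) z z * conj ((1 / 2) * horForm (sigmaMatrix σ) z z) :=
    funext (potential_eq σ)
  have hh : ∀ A B, complexHessian (potential σ) z A B =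
      hermForm (sigmaMatrix σ) z (Pi.single A 1) (Pi.single B 1) := by
    intro A B
    rw [complexHessian, hf, wirtinger_wirtingerBar_potential (sigmaMatrix_transpose σ),
      hermForm_apply]
  rw [metric, kahlerMetric_apply]
  simp only [hh]
  have h1 : ∑ A, ∑ B, hermForm (sigmaMatrix σ) z (Pi.single A 1) (Pi.single B 1) *
      ((v A * conj (w B) + w A * conj (v B)) / 2) =
      (1 / 2) * (hermForm (sigmaMatrix σ) z v w + hermForm (sigmaMatrix σ) z w v) := by
    rw [← sum_hermForm _ z v w, ← sum_hermForm _ z w v]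
    simp only [← Finset.sum_add_distrib, Finset.mul_sum]
    exact Finset.sum_congr rfl fun A _ => Finset.sum_congr rfl fun B _ => by ring
  have h2 := congrArg Complex.re h1
  simp only [Complex.re_sum] at h2
  rw [h2]
  -- The symmetric product averages `hermForm` over both orders of `v` and `w`; the two have the
  -- same real part.
  have h3 : ((1 / 2 : ℂ)) = ((1 / 2 : ℝ) : ℂ) := by norm_num
  rw [h3, Complex.re_ofReal_mul, Complex.add_re, re_hermForm, re_hermForm,
    quarticMetric_comm _ z w v]
  ring

end SemiRiem
end

noncomputable section

namespace SemiRiem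

/-! ### Connection, curvature and signature -/

variable {ι : Type*} [Fintype ι]

/-- `g` is the bundled form of `quarticMetric M`. -/
structure IsQuarticMetric (M : Matrix ι ι ℂ)
    (g : (ι ⊕ ι → ℂ) → (ι ⊕ ι → ℂ) →L[ℝ] (ι ⊕ ι → ℂ) →L[ℝ] ℝ) : Prop where
  transpose_eq : Mᵀ = M
  apply_eq : ∀ q v w, g q v w = quarticMetric M q v w

theorem contDiff_quarticMetric (M : Matrix ι ι ℂ) (v w : ι ⊕ ι → ℂ) {m : WithTop ℕ∞} :
    ContDiff ℝ m fun q => quarticMetric M q v w := by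
  have h1 : ContDiff ℝ m fun q => horForm M q v * conj (horForm M q w) :=
    (contDiff_horForm M contDiff_id contDiff_const).mul
      (contDiff_conj (contDiff_horForm M contDiff_id contDiff_const))
  exact contDiff_const.add (Complex.reCLM.contDiff.comp h1)

theorem hasDerivAt_quarticMetric_line (M : Matrix ι ι ℂ) (p X Y Z : ι ⊕ ι → ℂ) :
    HasDerivAt (fun t : ℝ => quarticMetric M (p + t • X) Y Z)
      (horForm M X Y * conj (horForm M p Z) + horForm M p Y * conj (horForm M X Z)).re 0 := by
  have h1 := (hasDerivAt_horForm_line (M := M) p X Y).mul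
    (hasDerivAt_conj (hasDerivAt_horForm_line (M := M) p X Z))
  have h2 := (Complex.reCLM.hasFDerivAt.comp_hasDerivAt (0 : ℝ) h1).const_add (pairing Y Z).re
  convert! h2 using 1
  simp only [zero_smul, add_zero]
  rfl

namespace IsQuarticMetric

variable {M : Matrix ι ι ℂ} {g : (ι ⊕ ι → ℂ) → (ι ⊕ ι → ℂ) →L[ℝ] (ι ⊕ ι → ℂ) →L[ℝ] ℝ}

theorem contDiff (hg : IsQuarticMetric M g) {m : WithTop ℕ∞} : ContDiff ℝ m g := by
  refine contDiff_clm_apply_iff.2 fun v => contDiff_clm_apply_iff.2 fun w => ?_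
  simp only [hg.apply_eq]
  exact contDiff_quarticMetric M v w

theorem isMetric (hg : IsQuarticMetric M g) : IsMetric g where
  smooth := hg.contDiff.contDiffOn
  symm p _ v w := by rw [hg.apply_eq, hg.apply_eq, quarticMetric_comm]
  nondegenerate p _ v h := by
    classical
    exact quarticMetric_nondegenerate M p v fun w => by rw [← hg.apply_eq, h w]

theorem fderiv_apply (hg : IsQuarticMetric M g) (p X Y Z : ι ⊕ ι → ℂ) :
    fderiv ℝ g p X Y Z =
      (horForm M X Y * conj (horForm M p Z) + horForm M p Y * conj (horForm M X Z)).re := by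
  have hd : DifferentiableAt ℝ g p := (hg.contDiff (m := 1)).contDiffAt.differentiableAt (by simp)
  have h1 : fderiv ℝ (fun q => g q Y Z) p X = fderiv ℝ g p X Y Z := by
    have h := (hd.hasFDerivAt.clm_apply (hasFDerivAt_const Y p)).clm_apply (hasFDerivAt_const Z p)
    rw [h.fderiv]; simp
  rw [← h1]
  simp only [hg.apply_eq]
  exact fderiv_apply_eq_of_hasDerivAt
    ((contDiff_quarticMetric M Y Z (m := 1)).contDiffAt.differentiableAt (by simp))
    (hasDerivAt_quarticMetric_line M p X Y Z)

/-- By symmetry of `H`, four of the six terms cancel in pairs up to conjugation, and the other two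
coincide. -/
theorem koszul_apply (hg : IsQuarticMetric M g) (p X Y Z : ι ⊕ ι → ℂ) :
    koszul g p X Y Z = (horForm M X Y * conj (horForm M p Z)).re := by
  rw [SemiRiem.koszul_apply, hg.fderiv_apply, hg.fderiv_apply, hg.fderiv_apply,
    horForm_comm hg.transpose_eq Y X, horForm_comm hg.transpose_eq Z X,
    horForm_comm hg.transpose_eq Z Y]
  simp only [Complex.add_re, Complex.mul_re, Complex.conj_re, Complex.conj_im]
  ring

/-- The candidate is vertical, so only the pairing sees it, and there `vertLift M p` reproduces
`conj H(p, Z)`. Non-degeneracy gives uniqueness. -/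
theorem christoffel_apply (hg : IsQuarticMetric M g) (p X Y : ι ⊕ ι → ℂ) :
    christoffel g p X Y = horForm M X Y • vertLift M p := by
  have hm := hg.isMetric
  rw [← sub_eq_zero]
  refine hm.nondegenerate p (Set.mem_univ p) _ fun Z => ?_
  rw [map_sub, sub_apply, metric_christoffel hm, hg.koszul_apply,
    hg.apply_eq, quarticMetric, map_smul, horForm_vertLift_right, pairing_smul_left,
    pairing_vertLift_left]
  simp

theorem contDiff_christoffel (hg : IsQuarticMetric M g) {m : WithTop ℕ∞} :
    ContDiff ℝ m (christoffel g) := by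
  refine contDiff_clm_apply_iff.2 fun v => contDiff_clm_apply_iff.2 fun w => ?_
  simp only [hg.christoffel_apply]
  exact (contDiff_vertLift M).const_smul (horForm M v w)

theorem fderiv_christoffel_apply (hg : IsQuarticMetric M g) (p W X Y : ι ⊕ ι → ℂ) :
    fderiv ℝ (christoffel g) p W X Y = horForm M X Y • vertLift M W := by
  have hd : DifferentiableAt ℝ (christoffel g) p :=
    (hg.contDiff_christoffel (m := 1)).contDiffAt.differentiableAt (by simp)
  have h1 : fderiv ℝ (fun q => christoffel g q X Y) p W =
      fderiv ℝ (christoffel g) p W X Y := by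
    have h := (hd.hasFDerivAt.clm_apply (hasFDerivAt_const X p)).clm_apply (hasFDerivAt_const Y p)
    rw [h.fderiv]; simp
  rw [← h1]
  simp only [hg.christoffel_apply]
  have h2 : HasFDerivAt (vertLift M) (LinearMap.toContinuousLinearMap (vertLiftL M)) p :=
    (LinearMap.toContinuousLinearMap (vertLiftL M)).hasFDerivAt
  have h3 : HasFDerivAt (fun q => horForm M X Y • vertLift M q) _ p :=
    h2.const_smul (horForm M X Y)
  rw [h3.fderiv]
  rfl

theorem curvature_apply (hg : IsQuarticMetric M g) (p X Y Z : ι ⊕ ι → ℂ) :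
    curvature g p X Y Z = horForm M Y Z • vertLift M X - horForm M X Z • vertLift M Y := by
  rw [SemiRiem.curvature_apply, hg.fderiv_christoffel_apply, hg.fderiv_christoffel_apply]
  simp [hg.christoffel_apply, horForm_vertLift_right]

theorem curvature_eq (hg : IsQuarticMetric M g) (p q : ι ⊕ ι → ℂ) :
    curvature g p = curvature g q := by
  ext X Y Z : 3
  rw [hg.curvature_apply, hg.curvature_apply]

theorem isLocallySymmetric (hg : IsQuarticMetric M g) : IsLocallySymmetric g := by
  intro p W X Y Z
  have h : curvature g = fun _ => curvature g 0 := funext fun q => hg.curvature_eq q 0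
  have h1 : fderiv ℝ (curvature g) p = 0 := by
    rw [h]; simp
  simp [covDerivCurvature, h1, hg.curvature_apply, hg.christoffel_apply, horForm_vertLift_left,
    horForm_vertLift_right, vertLift_vertLift, vertLift_smul]

theorem isRicciFlat (hg : IsQuarticMetric M g) : IsRicciFlat g := by
  intro p Y Z
  have h : IsNilpotent ((((curvature g p).flip Y).flip Z : (ι ⊕ ι → ℂ) →L[ℝ] (ι ⊕ ι → ℂ)) :
      (ι ⊕ ι → ℂ) →ₗ[ℝ] (ι ⊕ ι → ℂ)) := by
    -- `R(X, Y) Z` is vertical, and `R(·, Y) Z` kills vertical vectors.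
    refine ⟨2, LinearMap.ext fun X => ?_⟩
    rw [pow_two, Module.End.mul_apply, LinearMap.zero_apply]
    change curvature g p (curvature g p X Y Z) Y Z = 0
    rw [hg.curvature_apply p X, sub_eq_add_neg, ← neg_smul, hg.curvature_apply, vertLift_add,
      vertLift_smul, vertLift_smul, vertLift_vertLift, vertLift_vertLift]
    simp [horForm_vertLift_left]
  exact (LinearMap.isNilpotent_trace_of_isNilpotent h).eq_zero

theorem exists_curvature_ne_zero [DecidableEq ι] (hg : IsQuarticMetric M g) (h0 : M ≠ 0)
    (p : ι ⊕ ι → ℂ) : ∃ X Y Z, curvature g p X Y Z ≠ 0 := by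
  obtain ⟨a, b, hab⟩ : ∃ a b, M a b ≠ 0 := by
    by_contra! h
    exact h0 (Matrix.ext h)
  set e : ι → ι ⊕ ι → ℂ := fun a => Pi.single (Sum.inl a) 1
  have hv : ∀ a, vertLift M (e b) (Sum.inr a) = conj (M a b) := by
    intro a
    rw [vertLift_inr]
    simp [Matrix.mulVec, dotProduct, e, Pi.single_apply]
  have hf : horForm M (e b) (e a) = M a b := by
    simp [horForm_apply, Matrix.mulVec, dotProduct, e, Pi.single_apply]
  -- `H` is linear and `vertLift` antilinear, so on the complex line of `e b` the two terms of `R`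
  -- add up instead of cancelling: the entry `inr a` is `2 i |M a b|²`.
  refine ⟨e b, Complex.I • e b, e a, fun h => ?_⟩
  rw [hg.curvature_apply, vertLift_smul, map_smul, LinearMap.smul_apply, hf] at h
  have h1 := congrFun h (Sum.inr a)
  simp only [Pi.sub_apply, Pi.smul_apply, hv, smul_eq_mul, Complex.conj_I, Pi.zero_apply] at h1
  have h2 : 2 * Complex.I * M a b * conj (M a b) = 0 := by linear_combination h1
  simp [hab] at h2

theorem not_isFlat [DecidableEq ι] (hg : IsQuarticMetric M g) (h0 : M ≠ 0) : ¬ IsFlat g := by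
  intro h
  obtain ⟨X, Y, Z, hR⟩ := hg.exists_curvature_ne_zero h0 0
  exact hR (by simp [h 0])

theorem weyl_apply (hg : IsQuarticMetric M g) (p X Y Z T : ι ⊕ ι → ℂ) :
    weyl g p X Y Z T = g p (curvature g p X Y Z) T := by
  have hs : ∀ X Y, schouten g p X Y = 0 := by
    intro X Y
    have hsc : scalarCurvature g p = 0 := by simp [scalarCurvature, hg.isRicciFlat p]
    simp [schouten, hsc, hg.isRicciFlat p]
  simp [weyl, hs]

theorem not_isConformallyFlat [DecidableEq ι] (hg : IsQuarticMetric M g) (h0 : M ≠ 0) :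
    ¬ IsConformallyFlat g := by
  intro h
  obtain ⟨X, Y, Z, hR⟩ := hg.exists_curvature_ne_zero h0 0
  refine hR (hg.isMetric.nondegenerate 0 (Set.mem_univ _) _ fun T => ?_)
  rw [← hg.weyl_apply, h]

theorem isPseudoKahler (hg : IsQuarticMetric M g) : IsPseudoKahler g where
  isMetric := hg.isMetric
  hermitian p v w := by rw [hg.apply_eq, hg.apply_eq, quarticMetric_I_smul]
  closed p X Y Z := by
    simp only [hg.fderiv_apply, map_smul, smul_eq_mul]
    rw [horForm_comm hg.transpose_eq Y X, horForm_comm hg.transpose_eq Z X,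
      horForm_comm hg.transpose_eq Z Y]
    simp only [Complex.add_re, Complex.mul_re, Complex.mul_im, Complex.conj_re, Complex.conj_im,
      Complex.I_re, Complex.I_im]
    ring

/-- `g` is equivalent to `-g`, by the anti-isometry `(x, y) ↦ (x, -y - (pᵀ M x) conj (M p))`. -/
theorem quadForm_equivalent_neg (hg : IsQuarticMetric M g) (p : ι ⊕ ι → ℂ) :
    QuadraticMap.Equivalent (quadForm g p) (-quadForm g p) := by
  let θ : (ι ⊕ ι → ℂ) →ₗ[ℝ] (ι ⊕ ι → ℂ) :=
    { toFun := fun v => Sum.elim (fun a => v (Sum.inl a)) (fun a => -v (Sum.inr a)) -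
        horForm M p v • vertLift M p
      map_add' := fun v w => by
        ext (a | a)
        · simp
        · simp; ring
      map_smul' := fun r v => by
        ext (a | a)
        · simp
        · simp; ring }
  have hp : ∀ v, horForm M p (θ v) = horForm M p v := by
    intro v
    change horForm M p (_ - _) = _
    rw [map_sub, map_smul, horForm_vertLift_right, smul_zero, sub_zero]
    rfl
  have hθ : Function.Involutive θ := by
    intro v
    change _ - horForm M p (θ v) • vertLift M p = v
    rw [hp]
    ext (a | a)
    · simp [θ]
    · simp [θ]
  refine ⟨⟨LinearEquiv.ofInvolutive θ hθ, fun v => ?_⟩⟩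
  change -(g p (θ v) (θ v)) = g p v v
  have h1 : pairing (θ v) (θ v) = - pairing v v - 2 * (horForm M p v * conj (horForm M p v)) := by
    have h2 : θ v = Sum.elim (fun a => v (Sum.inl a)) (fun a => -v (Sum.inr a)) +
        (-horForm M p v) • vertLift M p := by
      rw [neg_smul, ← sub_eq_add_neg]; rfl
    have h3 : ∀ u : ι ⊕ ι → ℂ, horForm M u (Sum.elim (fun a => v (Sum.inl a))
        (fun a => -v (Sum.inr a))) = horForm M u v := fun u => rfl
    rw [h2]
    simp only [pairing_add_left, pairing_add_right, pairing_smul_left, pairing_smul_right,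
      pairing_vertLift_left, pairing_vertLift_right]
    have h4 : pairing (Sum.elim (fun a => v (Sum.inl a)) (fun a => -v (Sum.inr a)))
        (Sum.elim (fun a => v (Sum.inl a)) (fun a => -v (Sum.inr a))) = - pairing v v := by
      simp only [pairing, ← Finset.sum_neg_distrib]
      exact Finset.sum_congr rfl fun a _ => by simp; ring
    rw [h4, map_add, map_smul, h3, horForm_vertLift_right, map_neg, smul_zero, add_zero]
    ring
  rw [hg.apply_eq, hg.apply_eq, quarticMetric, quarticMetric, hp, h1, Complex.sub_re,
    Complex.neg_re]
  have h5 : ∀ c : ℂ, (2 * c).re = 2 * c.re := fun c => by simp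
  rw [h5]
  ring

/-- Equivalence with `-g` makes the two indices equal; the radical is zero, so they add up to the
real dimension `4 |ι|`. -/
theorem hasSignature (hg : IsQuarticMetric M g) :
    HasSignature g (2 * Fintype.card ι) (2 * Fintype.card ι) := by
  intro p
  have h1 := (hg.quadForm_equivalent_neg p).sigPos_eq
  rw [_root_.sigPos_neg] at h1
  have h2 := QuadraticForm.sigPos_add_sigNeg_add_radical (Q := quadForm g p)
  have h3 : Module.finrank ℝ (quadForm g p).radical = 0 := by
    have h : (quadForm g p).radical = ⊥ := by
      refine (Submodule.eq_bot_iff _).2 fun v hv => ?_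
      refine hg.isMetric.nondegenerate p (Set.mem_univ p) v fun w => ?_
      have h4 := (QuadraticMap.mem_radical_iff'.1 hv).2 w
      have h5 := (QuadraticMap.mem_radical_iff'.1 hv).1
      rw [quadForm_apply, quadForm_apply] at h4
      rw [quadForm_apply] at h5
      simp only [map_add, add_apply] at h4
      rw [hg.isMetric.symm p (Set.mem_univ p) w v] at h4
      linarith
    rw [h, finrank_bot]
  have h4 : Module.finrank ℝ (ι ⊕ ι → ℂ) = 4 * Fintype.card ι := by
    rw [Module.finrank_pi_fintype]
    simp [Complex.finrank_real_complex]
    ring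
  constructor <;> omega

end IsQuarticMetric

end SemiRiem
end

noncomputable section

namespace SemiRiem

/-! ### Geodesics and geodesic symmetries -/

theorem hasDerivAt_quadratic_line {F : Type*} [NormedAddCommGroup F] [NormedSpace ℝ F]
    (u v w : F) : HasDerivAt (fun t : ℝ => u + t • v + (t * t) • w) v 0 := by
  have h := (((hasDerivAt_id (0 : ℝ)).smul_const v).const_add u).add
    (((hasDerivAt_id (0 : ℝ)).mul (hasDerivAt_id (0 : ℝ))).smul_const w)
  convert! h using 1
  simp

variable {ι : Type*} [Fintype ι]

/-- The geodesic with initial point `p` and initial velocity `v`. -/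
def quarticGeodesic (M : Matrix ι ι ℂ) (p v : ι ⊕ ι → ℂ) (t : ℝ) : ι ⊕ ι → ℂ :=
  p + t • v - ((t ^ 2 / 2) • horForm M v v • vertLift M p +
    (t ^ 3 / 6) • horForm M v v • vertLift M v)

theorem hasDerivAt_quarticGeodesic (M : Matrix ι ι ℂ) (p v : ι ⊕ ι → ℂ) (t : ℝ) :
    HasDerivAt (quarticGeodesic M p v)
      (v - (t • horForm M v v • vertLift M p + (t ^ 2 / 2) • horForm M v v • vertLift M v)) t := by
  have h1 := ((hasDerivAt_id t).smul_const v).const_add p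
  have h2 := (((hasDerivAt_id t).pow 2).div_const 2).smul_const (horForm M v v • vertLift M p)
  have h3 := (((hasDerivAt_id t).pow 3).div_const 6).smul_const (horForm M v v • vertLift M v)
  convert! h1.sub (h2.add h3) using 1
  simp only [id, one_smul]
  congr 3
  · ring
  · ring

theorem deriv_quarticGeodesic (M : Matrix ι ι ℂ) (p v : ι ⊕ ι → ℂ) :
    deriv (quarticGeodesic M p v) = fun t =>
      v - (t • horForm M v v • vertLift M p + (t ^ 2 / 2) • horForm M v v • vertLift M v) :=
  funext fun t => (hasDerivAt_quarticGeodesic M p v t).deriv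

theorem deriv_deriv_quarticGeodesic (M : Matrix ι ι ℂ) (p v : ι ⊕ ι → ℂ) (t : ℝ) :
    deriv (deriv (quarticGeodesic M p v)) t =
      -(horForm M v v • vertLift M (p + t • v)) := by
  rw [deriv_quarticGeodesic]
  refine HasDerivAt.deriv ?_
  have h2 := (hasDerivAt_id t).smul_const (horForm M v v • vertLift M p)
  have h3 := (((hasDerivAt_id t).pow 2).div_const 2).smul_const (horForm M v v • vertLift M v)
  convert! (h2.add h3).const_sub v using 1
  rw [vertLift_add, vertLift_real_smul, smul_add, smul_comm (horForm M v v) t]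
  simp

theorem horForm_sub_vert (M : Matrix ι ι ℂ) (x y z : ι ⊕ ι → ℂ) (c : ℂ) (w : ι ⊕ ι → ℂ)
    (hx : x = z - c • vertLift M w) : horForm M x y = horForm M z y := by
  rw [hx, map_sub, map_smul, LinearMap.sub_apply, LinearMap.smul_apply, horForm_vertLift_left,
    smul_zero, sub_zero]

/-- The geodesic symmetry at `p`. -/
def quarticSymmetry (M : Matrix ι ι ℂ) (p q : ι ⊕ ι → ℂ) : ι ⊕ ι → ℂ :=
  (2 : ℂ) • p - q - horForm M (q - p) (q - p) • vertLift M p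

theorem contDiff_quarticSymmetry (M : Matrix ι ι ℂ) (p : ι ⊕ ι → ℂ) {m : WithTop ℕ∞} :
    ContDiff ℂ m (quarticSymmetry M p) := by
  have h : ∀ a, ContDiff ℂ m fun q : ι ⊕ ι → ℂ => (q - p) a := fun a =>
    (contDiff_apply ℂ ℂ a).comp (contDiff_id.sub contDiff_const)
  refine contDiff_pi.2 fun a => ?_
  simp only [quarticSymmetry, Pi.sub_apply, Pi.smul_apply, smul_eq_mul, horForm_apply,
    dotProduct, Matrix.mulVec]
  refine (contDiff_const.sub (contDiff_apply ℂ ℂ a)).sub (ContDiff.mul ?_ contDiff_const)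
  exact ContDiff.sum fun b _ => (ContDiff.sum fun c _ => contDiff_const.mul (h _)).mul (h _)

theorem fderiv_quarticSymmetry {M : Matrix ι ι ℂ} (hM : Mᵀ = M) (p q v : ι ⊕ ι → ℂ) :
    fderiv ℝ (quarticSymmetry M p) q v = -v - (2 * horForm M (q - p) v) • vertLift M p := by
  refine fderiv_apply_eq_of_hasDerivAt
    (((contDiff_quarticSymmetry M p (m := 1)).restrict_scalars ℝ).contDiffAt.differentiableAt
      (by simp)) ?_
  convert! hasDerivAt_quadratic_line (quarticSymmetry M p q)
    (-v - (2 * horForm M (q - p) v) • vertLift M p) (-(horForm M v v • vertLift M p)) using 1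
  ext t a
  have h : q + t • v - p = (q - p) + t • v := by abel
  simp only [quarticSymmetry, h, map_add, LinearMap.add_apply, horForm_real_smul_left,
    horForm_real_smul_right, Pi.add_apply, Pi.sub_apply, Pi.smul_apply, Pi.neg_apply, smul_eq_mul,
    Complex.real_smul, Complex.ofReal_mul]
  rw [horForm_comm hM v (q - p)]
  ring

/-- With `a = H(p, ·)` and `b = H(q, ·)`, the quartic term turns from `b conj b'` into `(2a - b)
conj (2a' - b')`. The vertical correction of the differential changes the pairing by exactly the
opposite amount. -/
theorem quarticMetric_quarticSymmetry (M : Matrix ι ι ℂ) (p q v w : ι ⊕ ι → ℂ) :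
    quarticMetric M (quarticSymmetry M p q)
      (-v - (2 * horForm M (q - p) v) • vertLift M p)
      (-w - (2 * horForm M (q - p) w) • vertLift M p) = quarticMetric M q v w := by
  have hs : ∀ u, horForm M (quarticSymmetry M p q) u =
      2 * horForm M p u - horForm M q u := by
    intro u
    rw [quarticSymmetry, horForm_sub_vert M _ u _ _ p rfl]
    simp
  have ht : ∀ (u v : ι ⊕ ι → ℂ) (c : ℂ), horForm M u (-v - c • vertLift M p) = -horForm M u v := by
    intro u v c
    rw [map_sub, map_smul, horForm_vertLift_right, smul_zero, sub_zero, map_neg]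
  have e : ∀ (u : ι ⊕ ι → ℂ) (c : ℂ), -u - c • vertLift M p = (-1 : ℂ) • u + (-c) • vertLift M p := by
    intro u c
    simp [sub_eq_add_neg]
  have hp : pairing (-v - (2 * horForm M (q - p) v) • vertLift M p)
      (-w - (2 * horForm M (q - p) w) • vertLift M p) = pairing v w +
      2 * horForm M (q - p) v * conj (horForm M p w) +
      2 * conj (horForm M (q - p) w) * horForm M p v := by
    rw [e, e]
    simp only [pairing_add_left, pairing_add_right, pairing_smul_left, pairing_smul_right,
      pairing_vertLift_left, pairing_vertLift_right, map_add, map_sub, LinearMap.sub_apply,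
      map_smul, smul_eq_mul, map_mul, map_neg, map_one, Complex.conj_ofNat, horForm_vertLift_right]
    ring
  rw [quarticMetric, quarticMetric, hp, hs, hs, ht, ht, ht, ht, ← Complex.add_re,
    ← Complex.add_re]
  simp only [map_sub, LinearMap.sub_apply, map_neg, map_mul, Complex.conj_ofNat]
  congr 1
  ring

namespace IsQuarticMetric

variable {M : Matrix ι ι ℂ} {g : (ι ⊕ ι → ℂ) → (ι ⊕ ι → ℂ) →L[ℝ] (ι ⊕ ι → ℂ) →L[ℝ] ℝ}

/-- The horizontal part moves on a straight line, so `H(γ', γ')` is the constant `H(v, v)` and the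
vertical equation has a right-hand side affine in `t`. Two integrations give the cubic. -/
theorem isGeodesicallyComplete (hg : IsQuarticMetric M g) : IsGeodesicallyComplete g := by
  intro p v
  refine ⟨quarticGeodesic M p v, ⟨?_, fun t => ?_⟩, ?_, ?_⟩
  · unfold quarticGeodesic
    fun_prop
  · rw [deriv_deriv_quarticGeodesic, hg.christoffel_apply]
    have h1 : ∀ y, horForm M (deriv (quarticGeodesic M p v) t) y = horForm M v y := by
      intro y
      rw [deriv_quarticGeodesic]
      simp [horForm_vertLift_left]
    have h2 : vertLift M (quarticGeodesic M p v t) = vertLift M (p + t • v) := by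
      rw [quarticGeodesic, ← vertLiftL_apply, map_sub, map_add, map_add,
        LinearMap.map_smul, LinearMap.map_smul, LinearMap.map_smul]
      simp [vertLiftL_apply, vertLift_smul, vertLift_vertLift, vertLift_add, vertLift_real_smul]
    rw [h1, horForm_comm hg.transpose_eq v (deriv _ t), h1, h2, neg_add_cancel]
  · simp [quarticGeodesic]
  · simp [deriv_quarticGeodesic]

theorem isSymmetryAt (hg : IsQuarticMetric M g) (p : ι ⊕ ι → ℂ) :
    IsSymmetryAt g p (quarticSymmetry M p) where
  smooth := (contDiff_quarticSymmetry M p).restrict_scalars ℝ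
  involutive q := by
    -- The symmetry negates the horizontal part of `q - p`, so the quadratic correction takes the
    -- same value at the image and cancels on the second application.
    have h : horForm M (quarticSymmetry M p q - p) (quarticSymmetry M p q - p) =
        horForm M (q - p) (q - p) := by
      have h1 : quarticSymmetry M p q - p =
          -(q - p) - horForm M (q - p) (q - p) • vertLift M p := by
        rw [quarticSymmetry, two_smul]; abel
      rw [horForm_sub_vert M _ _ _ _ p h1, horForm_comm hg.transpose_eq,
        horForm_sub_vert M _ _ _ _ p h1, map_neg, map_neg,
        LinearMap.neg_apply, neg_neg]
    rw [quarticSymmetry, h, quarticSymmetry]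
    abel
  isometry q v w := by
    rw [fderiv_quarticSymmetry hg.transpose_eq, fderiv_quarticSymmetry hg.transpose_eq,
      hg.apply_eq, hg.apply_eq, quarticMetric_quarticSymmetry]
  fixes := by simp [quarticSymmetry, two_smul]
  differential v := by
    rw [fderiv_quarticSymmetry hg.transpose_eq]
    simp

theorem isSymmetricSpace (hg : IsQuarticMetric M g) : IsSymmetricSpace g :=
  fun p => ⟨_, hg.isSymmetryAt p⟩

theorem isHermitianSymmetricSpace (hg : IsQuarticMetric M g) : IsHermitianSymmetricSpace g where
  isMetric := hg.isMetric
  hermitian := hg.isPseudoKahler.hermitian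
  symmetry p := ⟨_, hg.isSymmetryAt p,
    (contDiff_quarticSymmetry M p (m := 1)).differentiable (by simp)⟩

end IsQuarticMetric

end SemiRiem
end

noncomputable section

namespace SemiRiem

/-! ### Parallel transport and the holonomy algebra: upper bound -/

theorem exp_eq_one_add_of_mul_self_eq_zero {A : Type*} [NormedRing A] [NormedAlgebra ℝ A]
    {x : A} (hx : x * x = 0) : NormedSpace.exp x = 1 + x := by
  rw [NormedSpace.exp_eq_tsum ℝ]
  change ∑' n : ℕ, _ = _
  rw [tsum_eq_sum (s := Finset.range 2)]
  · simp [Finset.sum_range_succ]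
  · intro n hn
    obtain ⟨k, rfl⟩ : ∃ k, n = 2 + k := ⟨n - 2, by simp at hn; omega⟩
    rw [pow_add, pow_two, hx, zero_mul, smul_zero]

variable {ι : Type*} [Fintype ι]

/-- The endomorphism `(x, y) ↦ (0, B x)`, real-linear in `B`. -/
def vertMap : Matrix ι ι ℂ →ₗ[ℝ] ((ι ⊕ ι → ℂ) →L[ℝ] (ι ⊕ ι → ℂ)) where
  toFun B := LinearMap.toContinuousLinearMap
    (((Matrix.fromBlocks 0 0 B 0 : Matrix (ι ⊕ ι) (ι ⊕ ι) ℂ).mulVecLin).restrictScalars ℝ)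
  map_add' B C := by
    ext v a
    have h : (Matrix.fromBlocks 0 0 (B + C) 0 : Matrix (ι ⊕ ι) (ι ⊕ ι) ℂ) =
        Matrix.fromBlocks 0 0 B 0 + Matrix.fromBlocks 0 0 C 0 := by
      simp [Matrix.fromBlocks_add]
    simp [h]
  map_smul' r B := by
    ext v a
    have h : (Matrix.fromBlocks 0 0 (r • B) 0 : Matrix (ι ⊕ ι) (ι ⊕ ι) ℂ) =
        r • Matrix.fromBlocks 0 0 B 0 := by
      simp [Matrix.fromBlocks_smul]
    simp [h]

theorem vertMap_apply (B : Matrix ι ι ℂ) (v : ι ⊕ ι → ℂ) :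
    vertMap B v = (Matrix.fromBlocks 0 0 B 0 : Matrix (ι ⊕ ι) (ι ⊕ ι) ℂ) *ᵥ v := rfl

@[simp] theorem vertMap_apply_inl (B : Matrix ι ι ℂ) (v : ι ⊕ ι → ℂ) (a : ι) :
    vertMap B v (Sum.inl a) = 0 := by
  rw [vertMap_apply, Matrix.fromBlocks_mulVec]
  simp

theorem vertMap_apply_inr (B : Matrix ι ι ℂ) (v : ι ⊕ ι → ℂ) (a : ι) :
    vertMap B v (Sum.inr a) = (B *ᵥ fun b => v (Sum.inl b)) a := by
  rw [vertMap_apply, Matrix.fromBlocks_mulVec]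
  simp [Function.comp_def]

theorem vertMap_vertMap (B C : Matrix ι ι ℂ) (v : ι ⊕ ι → ℂ) : vertMap B (vertMap C v) = 0 := by
  ext (a | a)
  · simp
  · rw [vertMap_apply_inr]
    simp [Matrix.mulVec, dotProduct]

theorem horForm_vertMap_right (M B : Matrix ι ι ℂ) (x v : ι ⊕ ι → ℂ) :
    horForm M x (vertMap B v) = 0 := by
  simp [horForm_apply, dotProduct]

theorem pairing_vertMap_right (B : Matrix ι ι ℂ) (v w : ι ⊕ ι → ℂ) :
    pairing v (vertMap B w) =
      ∑ a, v (Sum.inl a) * conj ((B *ᵥ fun b => w (Sum.inl b)) a) := by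
  simp [pairing, vertMap_apply_inr]

theorem pairing_vertMap_left (B : Matrix ι ι ℂ) (v w : ι ⊕ ι → ℂ) :
    pairing (vertMap B v) w =
      ∑ a, (B *ᵥ fun b => v (Sum.inl b)) a * conj (w (Sum.inl a)) := by
  simp [pairing, vertMap_apply_inr]

theorem pairing_vertMap_vertMap (B : Matrix ι ι ℂ) (v w : ι ⊕ ι → ℂ) :
    pairing (vertMap B v) (vertMap B w) = 0 := by
  simp [pairing]

theorem hasDerivAt_pairing {V W : ℝ → ι ⊕ ι → ℂ} {v w : ι ⊕ ι → ℂ} {t : ℝ}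
    (hV : HasDerivAt V v t) (hW : HasDerivAt W w t) :
    HasDerivAt (fun t => pairing (V t) (W t)) (pairing v (W t) + pairing (V t) w) t := by
  have hV' := hasDerivAt_pi.1 hV
  have hW' := hasDerivAt_pi.1 hW
  have h : HasDerivAt (fun t => pairing (V t) (W t)) _ t := HasDerivAt.fun_sum fun a _ =>
    ((hV' (Sum.inl a)).mul (hasDerivAt_conj (hW' (Sum.inr a)))).add
    ((hV' (Sum.inr a)).mul (hasDerivAt_conj (hW' (Sum.inl a))))
  convert! h using 1
  simp only [pairing, ← Finset.sum_add_distrib]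
  exact Finset.sum_congr rfl fun a _ => by ring

theorem hasDerivAt_horForm (M : Matrix ι ι ℂ) {V W : ℝ → ι ⊕ ι → ℂ} {v w : ι ⊕ ι → ℂ} {t : ℝ}
    (hV : HasDerivAt V v t) (hW : HasDerivAt W w t) :
    HasDerivAt (fun t => horForm M (V t) (W t)) (horForm M v (W t) + horForm M (V t) w) t := by
  have hV' := hasDerivAt_pi.1 hV
  have hW' := hasDerivAt_pi.1 hW
  have h : HasDerivAt (fun t => horForm M (V t) (W t)) _ t := HasDerivAt.fun_sum fun a _ =>
    (HasDerivAt.fun_sum fun b _ => (hV' (Sum.inl b)).const_mul (M a b)).mul (hW' (Sum.inl a))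
  convert! h using 1
  simp only [horForm_apply, dotProduct, Matrix.mulVec, ← Finset.sum_add_distrib]

namespace IsQuarticMetric

variable {M : Matrix ι ι ℂ} {g : (ι ⊕ ι → ℂ) → (ι ⊕ ι → ℂ) →L[ℝ] (ι ⊕ ι → ℂ) →L[ℝ] ℝ}

theorem isParallelAlong_iff (hg : IsQuarticMetric M g) {γ V : ℝ → ι ⊕ ι → ℂ} :
    IsParallelAlong g γ V ↔
      ∀ t, HasDerivAt V (-(horForm M (deriv γ t) (V t) • vertLift M (γ t))) t := by
  simp only [IsParallelAlong, hg.christoffel_apply]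

/-- `Γ` is complex-linear in the transported vector, so the whole Hermitian form is conserved and
not only its real part. This is what makes the holonomy skew-Hermitian rather than merely skew for
the real part. -/
theorem hermForm_parallel (hg : IsQuarticMetric M g) {γ V W : ℝ → ι ⊕ ι → ℂ}
    (hγ : Differentiable ℝ γ) (hV : IsParallelAlong g γ V) (hW : IsParallelAlong g γ W)
    (s t : ℝ) : hermForm M (γ s) (V s) (W s) = hermForm M (γ t) (V t) (W t) := by
  rw [hg.isParallelAlong_iff] at hV hW
  have h : ∀ t, HasDerivAt (fun t => hermForm M (γ t) (V t) (W t)) 0 t := by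
    intro t
    have hd := (hγ t).hasDerivAt
    have h1 := (hasDerivAt_pairing (hV t) (hW t)).add ((hasDerivAt_horForm M hd (hV t)).mul
      (hasDerivAt_conj (hasDerivAt_horForm M hd (hW t))))
    convert! h1 using 1
    simp only [← neg_smul, pairing_smul_left, pairing_smul_right, map_smul,
      horForm_vertLift_right, pairing_vertLift_left, pairing_vertLift_right, map_neg]
    simp only [smul_zero, add_zero]
    ring
  exact is_const_of_deriv_eq_zero (fun t => (h t).differentiableAt) (fun t => (h t).deriv) s t

theorem parallel_inl (hg : IsQuarticMetric M g) {γ V : ℝ → ι ⊕ ι → ℂ}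
    (hV : IsParallelAlong g γ V) (s t : ℝ) (a : ι) : V s (Sum.inl a) = V t (Sum.inl a) := by
  rw [hg.isParallelAlong_iff] at hV
  have h : ∀ t, HasDerivAt (fun t => V t (Sum.inl a)) 0 t := by
    intro t
    simpa using hasDerivAt_pi.1 (hV t) (Sum.inl a)
  exact is_const_of_deriv_eq_zero (fun t => (h t).differentiableAt) (fun t => (h t).deriv) s t

/-- Parallel fields whose initial vectors are related by a complex-linear relation modulo vertical
vectors have constant linear combination. -/
theorem parallel_combination (hg : IsQuarticMetric M g) {γ V : ℝ → ι ⊕ ι → ℂ}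
    {κ : Type*} [Fintype κ] {W : κ → ℝ → ι ⊕ ι → ℂ} (c : κ → ℂ)
    (hV : IsParallelAlong g γ V) (hW : ∀ k, IsParallelAlong g γ (W k))
    (h0 : ∀ a, V 0 (Sum.inl a) = ∑ k, c k * W k 0 (Sum.inl a)) (s t : ℝ) :
    V s - ∑ k, c k • W k s = V t - ∑ k, c k • W k t := by
  have hx : ∀ t x, horForm M x (V t) = ∑ k, c k * horForm M x (W k t) := by
    intro t x
    have h1 : V t - ∑ k, c k • W k t =
        Sum.elim (0 : ι → ℂ) fun a => (V t - ∑ k, c k • W k t) (Sum.inr a) := by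
      ext (a | a)
      · rw [Pi.sub_apply, hg.parallel_inl hV t 0 a, h0, Finset.sum_apply]
        simp only [Pi.smul_apply, smul_eq_mul, hg.parallel_inl (hW _) t 0 a]
        simp
      · rfl
    have h2 : horForm M x (V t - ∑ k, c k • W k t) = 0 := by
      rw [h1]
      simp [horForm_apply, dotProduct]
    rw [map_sub, sub_eq_zero] at h2
    simpa using h2
  have h : ∀ t, HasDerivAt (fun t => V t - ∑ k, c k • W k t) 0 t := by
    intro t
    have h1 := ((hg.isParallelAlong_iff.1 hV t)).sub
      (HasDerivAt.fun_sum (u := Finset.univ) fun k _ =>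
        (hg.isParallelAlong_iff.1 (hW k) t).const_smul (c k))
    convert! h1 using 1
    rw [hx, Finset.sum_smul]
    simp [mul_smul]
  exact is_const_of_deriv_eq_zero (fun t => (h t).differentiableAt) (fun t => (h t).deriv) s t

/-- Transport is only assumed real-linear. Comparing the transport of `v` with those of the
horizontal basis vectors shows that its vertical increment is complex-linear in the horizontal part;
the columns of `B` are the increments of that basis. -/
theorem exists_vertMap_of_parallel [DecidableEq ι] (hg : IsQuarticMetric M g) {γ : ℝ → ι ⊕ ι → ℂ}
    {S : (ι ⊕ ι → ℂ) →L[ℝ] (ι ⊕ ι → ℂ)}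
    (hS : ∀ v, ∃ V : ℝ → ι ⊕ ι → ℂ, IsParallelAlong g γ V ∧ V 0 = v ∧ V 1 = S v) :
    ∃ B : Matrix ι ι ℂ, S = ContinuousLinearMap.id ℝ _ + vertMap B := by
  choose V hV hV0 hV1 using hS
  set e : ι → ι ⊕ ι → ℂ := fun b => Pi.single (Sum.inl b) 1
  refine ⟨Matrix.of fun a b => S (e b) (Sum.inr a), ContinuousLinearMap.ext fun v => ?_⟩
  have h := hg.parallel_combination (fun b => v (Sum.inl b)) (hV v) (fun b => hV (e b))
    (fun a => by simp [hV0, e, Pi.single_apply]) 1 0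
  simp only [hV0, hV1] at h
  ext (a | a)
  · have h1 := hg.parallel_inl (hV v) 1 0 a
    rw [hV0, hV1] at h1
    rw [add_apply, Pi.add_apply, vertMap_apply_inl, h1, add_zero, ContinuousLinearMap.id_apply]
  · have h1 := congrFun h (Sum.inr a)
    simp only [Pi.sub_apply, Finset.sum_apply, Pi.smul_apply, smul_eq_mul, e] at h1
    simp only [ne_eq, reduceCtorEq, not_false_eq_true, Pi.single_eq_of_ne, mul_zero,
      Finset.sum_const_zero, sub_zero] at h1
    rw [add_apply, Pi.add_apply, vertMap_apply_inr]
    simp only [Matrix.mulVec, dotProduct, ContinuousLinearMap.id_apply, Matrix.of_apply]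
    rw [sub_eq_iff_eq_add.1 h1]
    simp only [e, mul_comm]

theorem isParallelTransport_structure [DecidableEq ι] (hg : IsQuarticMetric M g)
    {p q : ι ⊕ ι → ℂ} {T : (ι ⊕ ι → ℂ) →L[ℝ] (ι ⊕ ι → ℂ)} (hT : IsParallelTransport g p q T) :
    (∃ B : Matrix ι ι ℂ, T = ContinuousLinearMap.id ℝ _ + vertMap B) ∧
      ∀ v w, hermForm M q (T v) (T w) = hermForm M p v w := by
  induction hT with
  | const => exact ⟨⟨0, by simp⟩, fun v w => rfl⟩
  | append γ S hT hγ hS ih =>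
    obtain ⟨⟨B, rfl⟩, hB⟩ := ih
    obtain ⟨C, hC⟩ := hg.exists_vertMap_of_parallel hS
    refine ⟨⟨B + C, ?_⟩, fun v w => ?_⟩
    -- `(1 + C)(1 + B) = 1 + B + C`, since `C B = 0` for maps from horizontal to vertical vectors.
    · ext v : 1
      rw [hC, map_add]
      simp [vertMap_vertMap, add_assoc, add_comm]
    · rw [← hB]
      obtain ⟨V, hV, hV0, hV1⟩ := hS ((ContinuousLinearMap.id ℝ (ι ⊕ ι → ℂ) + vertMap B) v)
      obtain ⟨W, hW, hW0, hW1⟩ := hS ((ContinuousLinearMap.id ℝ (ι ⊕ ι → ℂ) + vertMap B) w)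
      have h := hg.hermForm_parallel (hγ.differentiable (by simp)) hV hW 1 0
      rw [hV0, hV1, hW0, hW1] at h
      exact h

theorem holonomyGroup_subset [DecidableEq ι] (hg : IsQuarticMetric M g)
    {p : ι ⊕ ι → ℂ} {T : (ι ⊕ ι → ℂ) →L[ℝ] (ι ⊕ ι → ℂ)} (hT : T ∈ holonomyGroup g p) :
    ∃ B : Matrix ι ι ℂ, Bᴴ = -B ∧ T = ContinuousLinearMap.id ℝ _ + vertMap B := by
  obtain ⟨⟨B, rfl⟩, hB⟩ := hg.isParallelTransport_structure hT
  refine ⟨B, ?_, rfl⟩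
  ext a b
  -- Horizontal parts are unchanged, so the `H` terms agree and the isometry relation on basis
  -- vectors is `B b a + conj (B a b) = 0`.
  have h := hB (Pi.single (Sum.inl a) 1) (Pi.single (Sum.inl b) 1)
  simp only [add_apply, ContinuousLinearMap.id_apply, map_add, LinearMap.add_apply,
    hermForm_apply, horForm_vertMap_right, pairing_vertMap_vertMap, map_zero, mul_zero, zero_mul,
    add_zero] at h
  rw [pairing_vertMap_left, pairing_vertMap_right] at h
  simp only [Matrix.mulVec, dotProduct, Pi.single_apply, Sum.inl.injEq, mul_ite, mul_one, mul_zero,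
    Finset.sum_ite_eq', Finset.mem_univ, if_true, ite_mul, one_mul, zero_mul, apply_ite conj,
    map_one, map_zero] at h
  rw [Matrix.conjTranspose_apply, Matrix.neg_apply]
  have h1 : B b a = -conj (B a b) := by linear_combination h
  rw [h1]
  simp

theorem holonomyAlgebra_subset [DecidableEq ι] (hg : IsQuarticMetric M g)
    {p : ι ⊕ ι → ℂ} {A : (ι ⊕ ι → ℂ) →L[ℝ] (ι ⊕ ι → ℂ)} (hA : A ∈ holonomyAlgebra g p) :
    ∃ B : Matrix ι ι ℂ, Bᴴ = -B ∧ A = vertMap B := by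
  let K : Submodule ℝ ((ι ⊕ ι → ℂ) →L[ℝ] (ι ⊕ ι → ℂ)) :=
    (skewAdjoint.submodule ℝ (Matrix ι ι ℂ)).map vertMap
  have hK : IsClosed (K : Set ((ι ⊕ ι → ℂ) →L[ℝ] (ι ⊕ ι → ℂ))) :=
    Submodule.closed_of_finiteDimensional K
  have hmem : A ∈ K := by
    -- `A` is the limit of the difference quotients of `exp (t A)` at `0`, which all lie in the
    -- closed subspace `K`.
    have h1 := hasDerivAt_exp_smul_const (𝕂 := ℝ) A (0 : ℝ)
    rw [zero_smul, NormedSpace.exp_zero, one_mul] at h1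
    refine hK.mem_of_tendsto h1.tendsto_slope (Filter.Eventually.of_forall fun t => ?_)
    obtain ⟨B, hB, h2⟩ := hg.holonomyGroup_subset (hA t)
    rw [slope_def_module, h2, zero_smul, NormedSpace.exp_zero]
    refine K.smul_mem _ ⟨B, hB, ?_⟩
    rw [add_comm, ← ContinuousLinearMap.one_def, add_sub_cancel_right]
  obtain ⟨B, hB, rfl⟩ := hmem
  exact ⟨B, hB, rfl⟩

end IsQuarticMetric

end SemiRiem
end

noncomputable section

namespace SemiRiem

/-! ### Circles and the full holonomy algebra -/

variable {ι : Type*} [Fintype ι]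

theorem conj_exp_ofReal_mul {τ : ℂ} (hτ : conj τ = -τ) (t : ℝ) :
    conj (Complex.exp (t * τ)) * Complex.exp (t * τ) = 1 := by
  rw [← Complex.exp_conj, map_mul, Complex.conj_ofReal, hτ, ← Complex.exp_add]
  simp

/-- A circle through `p` in the complex line spanned by `u`. -/
def circleLoop (τ : ℂ) (p u : ι ⊕ ι → ℂ) (t : ℝ) : ι ⊕ ι → ℂ :=
  p + (Complex.exp (t * τ) - 1) • u

theorem hasDerivAt_exp_ofReal_mul (τ : ℂ) (t : ℝ) :
    HasDerivAt (fun t : ℝ => Complex.exp (t * τ)) (Complex.exp (t * τ) * τ) t := by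
  have h := ((Complex.ofRealCLM.hasDerivAt (x := t)).mul_const τ).cexp
  simpa using h

theorem deriv_circleLoop (τ : ℂ) (p u : ι ⊕ ι → ℂ) (t : ℝ) :
    deriv (circleLoop τ p u) t = (Complex.exp (t * τ) * τ) • u :=
  ((((hasDerivAt_exp_ofReal_mul τ t).sub_const 1).smul_const u).const_add p).deriv

theorem contDiff_circleLoop (τ : ℂ) (p u : ι ⊕ ι → ℂ) : ContDiff ℝ ∞ (circleLoop τ p u) := by
  refine contDiff_pi.2 fun a => ?_
  have h : ContDiff ℝ ∞ fun t : ℝ => Complex.exp (t * τ) :=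
    (Complex.ofRealCLM.contDiff.mul contDiff_const).cexp
  exact contDiff_const.add ((h.sub contDiff_const).mul contDiff_const)

/-- The parallel vector field along `circleLoop` with initial value `v`. -/
def circleParallel (M : Matrix ι ι ℂ) (τ : ℂ) (p u v : ι ⊕ ι → ℂ) (t : ℝ) : ι ⊕ ι → ℂ :=
  v - horForm M u v • ((Complex.exp (t * τ) - 1) • vertLift M (p - u) + (t * τ) • vertLift M u)

theorem vertLift_eq_vertMap [DecidableEq ι] (M : Matrix ι ι ℂ) (u v : ι ⊕ ι → ℂ) :
    horForm M u v • vertLift M u = vertMap (Matrix.vecMulVec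
      (star (M *ᵥ fun a => u (Sum.inl a))) (M *ᵥ fun a => u (Sum.inl a))) v := by
  ext (a | a)
  · simp
  · rw [vertMap_apply_inr, Pi.smul_apply, vertLift_inr, horForm_apply, Matrix.vecMulVec_mulVec]
    simp [mul_comm]

namespace IsQuarticMetric

variable {M : Matrix ι ι ℂ} {g : (ι ⊕ ι → ℂ) → (ι ⊕ ι → ℂ) →L[ℝ] (ι ⊕ ι → ℂ) →L[ℝ] ℝ}

/-- As `|exp (t τ)| = 1`, the part of `vertLift γ` along `u` carries the conjugate phase of `γ'`.
Their product is constant and integrates to the secular term `t τ`; the rest integrates to a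
periodic term when `exp τ = 1`. -/
theorem isParallelAlong_circleParallel (hg : IsQuarticMetric M g) {τ : ℂ} (hτ : conj τ = -τ)
    (p u v : ι ⊕ ι → ℂ) :
    IsParallelAlong g (circleLoop τ p u) (circleParallel M τ p u v) := by
  rw [hg.isParallelAlong_iff]
  intro t
  have h1 : HasDerivAt (fun t : ℝ => (t : ℂ) * τ) τ t := by
    simpa using (Complex.ofRealCLM.hasDerivAt (x := t)).mul_const τ
  have h := ((((((hasDerivAt_exp_ofReal_mul τ t).sub_const 1).smul_const
    (vertLift M (p - u))).add (h1.smul_const (vertLift M u))).const_smul (horForm M u v)).const_sub v)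
  convert! h using 1
  have h2 : horForm M (deriv (circleLoop τ p u) t) (circleParallel M τ p u v t) =
      Complex.exp (t * τ) * τ * horForm M u v := by
    rw [deriv_circleLoop, circleParallel]
    simp [horForm_vertLift_right]
  have h3 : vertLift M (circleLoop τ p u t) =
      vertLift M (p - u) + conj (Complex.exp (t * τ)) • vertLift M u := by
    have h4 : circleLoop τ p u t = (p - u) + Complex.exp (t * τ) • u := by
      rw [circleLoop, sub_smul, one_smul]; abel
    rw [h4, vertLift_add, vertLift_smul]
  rw [h2, h3]
  ext a
  simp only [Pi.neg_apply, Pi.smul_apply, Pi.add_apply, smul_eq_mul]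
  linear_combination (-(τ * horForm M u v * vertLift M u a)) * conj_exp_ofReal_mul hτ t

/-- After a full turn only the secular term survives; its rank-one matrix is added to `B`. -/
theorem append_circleLoop [DecidableEq ι] (hg : IsQuarticMetric M g) {τ : ℂ} (hτ : conj τ = -τ)
    (hτ1 : Complex.exp τ = 1) {p : ι ⊕ ι → ℂ} (u : ι ⊕ ι → ℂ) {B : Matrix ι ι ℂ}
    (hB : ContinuousLinearMap.id ℝ _ + vertMap B ∈ holonomyGroup g p) :
    ContinuousLinearMap.id ℝ _ + vertMap (B + (-τ) • Matrix.vecMulVec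
      (star (M *ᵥ fun a => u (Sum.inl a))) (M *ᵥ fun a => u (Sum.inl a))) ∈ holonomyGroup g p := by
  set C : Matrix ι ι ℂ := (-τ) • Matrix.vecMulVec
      (star (M *ᵥ fun a => u (Sum.inl a))) (M *ᵥ fun a => u (Sum.inl a)) with hC
  have h0 : circleLoop τ p u 0 = p := by simp [circleLoop]
  have h1 : circleLoop τ p u 1 = p := by simp [circleLoop, hτ1]
  have hCv : ∀ v, vertMap C v = (-τ) • (horForm M u v • vertLift M u) := by
    intro v
    rw [vertLift_eq_vertMap, hC]
    ext (a | a)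
    · simp
    · rw [vertMap_apply_inr, Pi.smul_apply, vertMap_apply_inr, Matrix.smul_mulVec, Pi.smul_apply]
  have h := IsParallelTransport.append (g := g) (p := p) (circleLoop τ p u)
    (ContinuousLinearMap.id ℝ _ + vertMap C) (T := ContinuousLinearMap.id ℝ _ + vertMap B)
    (by rw [h0]; exact hB) (contDiff_circleLoop τ p u)
    (fun v => ⟨_, hg.isParallelAlong_circleParallel hτ p u v, by simp [circleParallel], by
      rw [add_apply, hCv]
      simp only [circleParallel, hτ1, Complex.ofReal_one, one_mul, sub_self, zero_smul, zero_add,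
        ContinuousLinearMap.id_apply, neg_smul, sub_eq_add_neg]
      rw [smul_comm]⟩)
  rw [h1] at h
  convert! h using 1
  ext v : 1
  rw [map_add]
  simp [vertMap_vertMap, add_assoc, add_comm]

theorem mem_holonomyGroup [DecidableEq ι] (hg : IsQuarticMetric M g) (hM : IsUnit M)
    (p : ι ⊕ ι → ℂ) {B : Matrix ι ι ℂ} (hB : Bᴴ = -B) :
    ContinuousLinearMap.id ℝ _ + vertMap B ∈ holonomyGroup g p := by
  -- The spectral theorem for `i B` splits `B` into rank-one terms with imaginary coefficients, each
  -- realised by one circle.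
  have hH : (Complex.I • B).IsHermitian := by
    rw [Matrix.IsHermitian, Matrix.conjTranspose_smul, hB]
    simp
  set U : Matrix ι ι ℂ := (hH.eigenvectorUnitary : Matrix.unitaryGroup ι ℂ).1
  set l := hH.eigenvalues
  have hsum : B = ∑ k, (-Complex.I * l k) • Matrix.vecMulVec (fun a => U a k)
      (fun b => conj (U b k)) := by
    have h := hH.spectral_theorem
    rw [Unitary.conjStarAlgAut_apply] at h
    ext a b
    have h1 := congrFun (congrFun h a) b
    rw [Matrix.smul_apply, smul_eq_mul, Matrix.mul_apply] at h1
    have h2 : B a b = -Complex.I * (Complex.I * B a b) := by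
      rw [← mul_assoc]; simp
    rw [h2, h1, Finset.mul_sum, Matrix.sum_apply]
    refine Finset.sum_congr rfl fun k _ => ?_
    rw [Matrix.mul_diagonal]
    simp [Matrix.vecMulVec_apply, Matrix.star_apply, U, l]
    ring
  have hlift : ∀ u : ι → ℂ, ∃ w : ι ⊕ ι → ℂ, (M *ᵥ fun a => w (Sum.inl a)) = u := by
    intro u
    refine ⟨Sum.elim (M⁻¹ *ᵥ u) 0, ?_⟩
    change M *ᵥ (M⁻¹ *ᵥ u) = u
    rw [Matrix.mulVec_mulVec, Matrix.mul_nonsing_inv M ((Matrix.isUnit_iff_isUnit_det M).1 hM),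
      Matrix.one_mulVec]
  -- The sign of the eigenvalue `r` chooses the orientation `τ = ± 2πi`, its size the scale `s =
  -- √(|r| / 2π)` of the circle.
  have hτ : ∀ r : ℝ, ∃ τ : ℂ, ∃ s : ℝ, conj τ = -τ ∧ Complex.exp τ = 1 ∧
      -τ * (s * s) = -Complex.I * r := by
    intro r
    have hpi : (Real.pi : ℂ) ≠ 0 := by exact_mod_cast Real.pi_ne_zero
    rcases le_total 0 r with h | h
    · refine ⟨2 * Real.pi * Complex.I, Real.sqrt (r / (2 * Real.pi)),
        by simp [Complex.conj_ofNat],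
        Complex.exp_two_pi_mul_I, ?_⟩
      rw [← Complex.ofReal_mul, Real.mul_self_sqrt (by positivity)]
      push_cast
      field_simp
    · refine ⟨-(2 * Real.pi * Complex.I), Real.sqrt (-r / (2 * Real.pi)),
        by simp [Complex.conj_ofNat], by
        rw [Complex.exp_neg, Complex.exp_two_pi_mul_I, inv_one], ?_⟩
      rw [← Complex.ofReal_mul, Real.mul_self_sqrt (div_nonneg (by linarith) (by positivity))]
      push_cast
      field_simp
  rw [hsum]
  have key : ∀ s : Finset ι, ContinuousLinearMap.id ℝ _ + vertMap (∑ k ∈ s,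
      (-Complex.I * l k) • Matrix.vecMulVec (fun a => U a k) (fun b => conj (U b k))) ∈
      holonomyGroup g p := by
    intro s
    induction s using Finset.induction_on with
    | empty =>
      rw [Finset.sum_empty, map_zero, add_zero]
      exact IsParallelTransport.const p
    | insert k s hk ih =>
      obtain ⟨τ, c, h1, h2, h3⟩ := hτ (l k)
      obtain ⟨u, hu⟩ := hlift fun a => c * conj (U a k)
      have h4 : (-τ) • Matrix.vecMulVec (star fun a => c * conj (U a k))
          (fun a => c * conj (U a k)) = (-Complex.I * l k) • Matrix.vecMulVec (fun a => U a k)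
          (fun b => conj (U b k)) := by
        rw [← h3]
        ext a b
        simp only [Matrix.smul_apply, Matrix.vecMulVec_apply, Pi.star_apply, star_mul',
          RCLike.star_def, Complex.conj_conj, Complex.conj_ofReal, smul_eq_mul]
        ring
      have h := hg.append_circleLoop h1 h2 u ih
      rw [hu, h4] at h
      rwa [Finset.sum_insert hk, add_comm (_ • _)]
  exact key _

theorem mem_holonomyAlgebra [DecidableEq ι] (hg : IsQuarticMetric M g) (hM : IsUnit M)
    (p : ι ⊕ ι → ℂ) {B : Matrix ι ι ℂ} (hB : Bᴴ = -B) : vertMap B ∈ holonomyAlgebra g p := by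
  intro t
  have h : (t • vertMap B) * (t • vertMap B) = 0 := by
    ext v : 1
    simp [vertMap_vertMap]
  rw [exp_eq_one_add_of_mul_self_eq_zero h, ← map_smul]
  refine hg.mem_holonomyGroup hM p ?_
  rw [Matrix.conjTranspose_smul, hB]
  simp

theorem mem_holonomyAlgebra_iff [DecidableEq ι] (hg : IsQuarticMetric M g) (hM : IsUnit M)
    (p : ι ⊕ ι → ℂ) (A : (ι ⊕ ι → ℂ) →L[ℝ] (ι ⊕ ι → ℂ)) :
    A ∈ holonomyAlgebra g p ↔ ∃ B : Matrix ι ι ℂ, Bᴴ = -B ∧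
      ∀ v, A v = (Matrix.fromBlocks 0 0 B 0 : Matrix (ι ⊕ ι) (ι ⊕ ι) ℂ) *ᵥ v := by
  constructor
  · intro hA
    obtain ⟨B, hB, rfl⟩ := hg.holonomyAlgebra_subset hA
    exact ⟨B, hB, fun v => rfl⟩
  · rintro ⟨B, hB, hA⟩
    have h : A = vertMap B := ContinuousLinearMap.ext fun v => hA v
    rw [h]
    exact hg.mem_holonomyAlgebra hM p hB

end IsQuarticMetric

/-! ### Skew-Hermitian maps and indecomposable holonomy -/

open scoped ComplexOrder in
theorem exists_skewHermitian_mulVec_eq {v u : ι → ℂ} (hv : v ≠ 0)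
    (h : (u ⬝ᵥ star v).re = 0) : ∃ B : Matrix ι ι ℂ, Bᴴ = -B ∧ B *ᵥ v = u := by
  set N : ℂ := v ⬝ᵥ star v with hN
  have hN0 : N ≠ 0 := by
    rw [hN, Ne, dotProduct_comm, dotProduct_star_self_eq_zero]
    exact hv
  have hNc : conj N = N := by
    rw [hN, dotProduct_comm, starRingEnd_apply, ← Matrix.star_dotProduct_star]
    simp [dotProduct_comm]
  set c : ℂ := u ⬝ᵥ star v with hc
  have hcc : conj c = -c := by
    apply Complex.ext
    · simp [h]
    · simp
  have hvu : star u ⬝ᵥ v = -c := by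
    rw [← hcc, hc, starRingEnd_apply, ← Matrix.star_dotProduct_star, star_star, dotProduct_comm]
  -- The first summand maps `v` to `u + (c / N) v`. The second removes the excess, and is
  -- skew-Hermitian because `c` is imaginary.
  refine ⟨N⁻¹ • (Matrix.vecMulVec u (star v) - Matrix.vecMulVec v (star u)) -
    (c / (N * N)) • Matrix.vecMulVec v (star v), ?_, ?_⟩
  · ext a b
    simp [Matrix.vecMulVec_apply, Matrix.conjTranspose_apply, hNc, hcc]
    ring
  · rw [Matrix.sub_mulVec, Matrix.smul_mulVec, Matrix.smul_mulVec, Matrix.sub_mulVec,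
      Matrix.vecMulVec_mulVec, Matrix.vecMulVec_mulVec, Matrix.vecMulVec_mulVec, hvu,
      dotProduct_comm (star v), ← hN]
    ext a
    simp
    field_simp
    ring

/-- Two real conditions on a real space of dimension `2 |ι| ≥ 4`. -/
theorem exists_ne_zero_re_dotProduct_eq_zero [Nontrivial ι] (v w : ι → ℂ) :
    ∃ u : ι → ℂ, u ≠ 0 ∧ (u ⬝ᵥ star v).re = 0 ∧ (u ⬝ᵥ star w).re = 0 := by
  let L : (ι → ℂ) →ₗ[ℝ] ℝ × ℝ :=
    { toFun := fun u => ((u ⬝ᵥ star v).re, (u ⬝ᵥ star w).re)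
      map_add' := fun x y => by simp [add_dotProduct]
      map_smul' := fun r x => by simp [smul_dotProduct] }
  have hL : L.ker ≠ ⊥ := by
    refine LinearMap.ker_ne_bot_of_finrank_lt ?_
    rw [Module.finrank_pi_fintype]
    have := Fintype.one_lt_card (α := ι)
    simp [Complex.finrank_real_complex]
    omega
  obtain ⟨u, hu, hu0⟩ := (Submodule.ne_bot_iff _).1 hL
  have h := LinearMap.mem_ker.1 hu
  exact ⟨u, hu0, congrArg Prod.fst h, congrArg Prod.snd h⟩

/-- A subspace of vertical vectors is totally isotropic, so each summand contains a vector with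
nonzero horizontal part. Some nonzero `u` is real-orthogonal to both of these parts, and
skew-Hermitian matrices send each of them to `u`. Invariance puts `(0, u)` in both summands. -/
theorem IsQuarticMetric.isHolonomyIndecomposableAt [DecidableEq ι] [Nontrivial ι]
    {M : Matrix ι ι ℂ} {g : (ι ⊕ ι → ℂ) → (ι ⊕ ι → ℂ) →L[ℝ] (ι ⊕ ι → ℂ) →L[ℝ] ℝ}
    (hg : IsQuarticMetric M g) (hM : IsUnit M) (p : ι ⊕ ι → ℂ) :
    IsHolonomyIndecomposableAt g p := by
  rintro ⟨W, hW, h⟩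
  have hx : ∀ k, ∃ v ∈ W k, (fun a => v (Sum.inl a)) ≠ 0 := by
    intro k
    by_contra! h0
    obtain ⟨hne, -, hnd⟩ := h k
    refine hne ((Submodule.eq_bot_iff _).2 fun v hv => hnd v hv fun w hw => ?_)
    rw [hg.apply_eq, quarticMetric_vert _ _ _ _ fun a => congrFun (h0 v hv) a]
    have h1 := fun a => congrFun (h0 w hw) a
    simp only [Pi.zero_apply] at h1
    simp [h1]
  obtain ⟨v, hv, hv0⟩ := hx 0
  obtain ⟨w, hw, hw0⟩ := hx 1
  obtain ⟨u, hu0, huv, huw⟩ := exists_ne_zero_re_dotProduct_eq_zero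
    (fun a => v (Sum.inl a)) (fun a => w (Sum.inl a))
  obtain ⟨B, hB, hBv⟩ := exists_skewHermitian_mulVec_eq hv0 huv
  obtain ⟨C, hC, hCw⟩ := exists_skewHermitian_mulVec_eq hw0 huw
  have e1 := (h 0).2.1 _ (hg.mem_holonomyAlgebra hM p hB) v hv
  have e2 := (h 1).2.1 _ (hg.mem_holonomyAlgebra hM p hC) w hw
  have e3 : vertMap B v = vertMap C w := by
    ext (a | a)
    · simp
    · rw [vertMap_apply_inr, vertMap_apply_inr, hBv, hCw]
  have e4 := Submodule.disjoint_def.1 hW.disjoint _ e1 (e3 ▸ e2)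
  refine hu0 (funext fun a => ?_)
  have e5 := congrFun e4 (Sum.inr a)
  rwa [vertMap_apply_inr, hBv] at e5

end SemiRiem
end

noncomputable section

namespace SemiRiem

/-! ### Local products -/

section ProductChart

variable {E : Type*} [NormedAddCommGroup E] [NormedSpace ℝ E]
  {F₁ : Type*} [NormedAddCommGroup F₁] [NormedSpace ℝ F₁]
  {F₂ : Type*} [NormedAddCommGroup F₂] [NormedSpace ℝ F₂]

theorem two_le_infty : (2 : WithTop ℕ∞) ≤ ∞ :=
  WithTop.coe_le_coe.2 (le_top : (2 : ℕ∞) ≤ ⊤)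

/-- Pointwise form, needed for the factors of a product, which are metrics only on `V₁` and `V₂`. -/
theorem metric_christoffel_of_nondegenerate [FiniteDimensional ℝ E]
    {g : E → E →L[ℝ] E →L[ℝ] ℝ} {p : E} (hg : ∀ v, (∀ w, g p v w = 0) → v = 0) (X Y Z : E) :
    g p (christoffel g p X Y) Z = koszul g p X Y Z := by
  have hinj : Function.Injective (g p : E →ₗ[ℝ] (E →L[ℝ] ℝ)) := by
    refine (injective_iff_map_eq_zero (g p : E →ₗ[ℝ] (E →L[ℝ] ℝ))).2 fun v hv => hg v fun w => ?_
    have h2 : g p v = 0 := hv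
    simp [h2]
  have hdim : Module.finrank ℝ E = Module.finrank ℝ (E →L[ℝ] ℝ) := by
    rw [← Subspace.dual_finrank_eq (K := ℝ) (V := E)]
    exact LinearEquiv.finrank_eq (LinearMap.toContinuousLinearMap (𝕜 := ℝ) (E := E) (F' := ℝ))
  let e := (LinearEquiv.ofInjectiveOfFinrankEq _ hinj hdim).toContinuousLinearEquiv
  have he : (e : E →L[ℝ] (E →L[ℝ] ℝ)) = g p := by
    ext v w
    rfl
  rw [christoffel_apply, ← he, ContinuousLinearMap.inverse_equiv]
  simp

theorem koszul_comm {g : E → E →L[ℝ] E →L[ℝ] ℝ} (hg : IsMetric g) (p X Y Z : E) :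
    koszul g p X Y Z = koszul g p Y X Z := by
  have hd : HasFDerivAt g (fderiv ℝ g p) p :=
    ((contDiffOn_univ.1 hg.smooth).contDiffAt.differentiableAt (by simp)).hasFDerivAt
  have h1 := (hd.clm_apply (hasFDerivAt_const X p)).clm_apply (hasFDerivAt_const Y p)
  have h2 := (hd.clm_apply (hasFDerivAt_const Y p)).clm_apply (hasFDerivAt_const X p)
  have he : (fun q => g q X Y) = fun q => g q Y X :=
    funext fun q => hg.symm q (Set.mem_univ q) X Y
  rw [he] at h1
  have h3 := DFunLike.congr_fun (h1.unique h2) Z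
  simp only [ContinuousLinearMap.comp_zero, ContinuousLinearMap.flip_apply, zero_add] at h3
  rw [koszul_apply, koszul_apply, h3]
  ring

theorem christoffel_comm [FiniteDimensional ℝ E] {g : E → E →L[ℝ] E →L[ℝ] ℝ} (hg : IsMetric g)
    (p X Y : E) : christoffel g p X Y = christoffel g p Y X := by
  rw [christoffel_apply, christoffel_apply]
  congr 1
  ext Z
  exact koszul_comm hg p X Y Z

theorem fderiv_christoffel_comm [FiniteDimensional ℝ E] {g : E → E →L[ℝ] E →L[ℝ] ℝ}
    (hg : IsMetric g) {p : E} (hΓ : DifferentiableAt ℝ (christoffel g) p) (W X Y : E) :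
    fderiv ℝ (christoffel g) p W X Y = fderiv ℝ (christoffel g) p W Y X := by
  have h1 := (hΓ.hasFDerivAt.clm_apply (hasFDerivAt_const X p)).clm_apply (hasFDerivAt_const Y p)
  have h2 := (hΓ.hasFDerivAt.clm_apply (hasFDerivAt_const Y p)).clm_apply (hasFDerivAt_const X p)
  have he : (fun q => christoffel g q X Y) = fun q => christoffel g q Y X :=
    funext fun q => christoffel_comm hg q X Y
  rw [he] at h1
  have h3 := DFunLike.congr_fun (h1.unique h2) W
  simpa only [ContinuousLinearMap.comp_zero,
    ContinuousLinearMap.flip_apply, zero_add] using h3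

/-- `ψ` is an isometric local parametrisation of `(E, g)` by the product
`(V₁ × V₂, g₁ ⊕ g₂)`. -/
structure IsProductParametrization (g : E → E →L[ℝ] E →L[ℝ] ℝ) (g₁ : F₁ → F₁ →L[ℝ] F₁ →L[ℝ] ℝ)
    (g₂ : F₂ → F₂ →L[ℝ] F₂ →L[ℝ] ℝ) (V₁ : Set F₁) (V₂ : Set F₂) (ψ : F₁ × F₂ → E) : Prop where
  isOpen_left : IsOpen V₁
  isOpen_right : IsOpen V₂
  metric_left : IsMetricOn g₁ V₁
  metric_right : IsMetricOn g₂ V₂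
  smooth : ContDiffOn ℝ ∞ ψ (V₁ ×ˢ V₂)
  isometry : ∀ y ∈ V₁ ×ˢ V₂, ∀ a b, g (ψ y) (fderiv ℝ ψ y a) (fderiv ℝ ψ y b) =
    g₁ y.1 a.1 b.1 + g₂ y.2 a.2 b.2
  surjective : ∀ y ∈ V₁ ×ˢ V₂, Function.Surjective (fderiv ℝ ψ y)

namespace IsProductParametrization

variable {g : E → E →L[ℝ] E →L[ℝ] ℝ} {g₁ : F₁ → F₁ →L[ℝ] F₁ →L[ℝ] ℝ}
  {g₂ : F₂ → F₂ →L[ℝ] F₂ →L[ℝ] ℝ} {V₁ : Set F₁} {V₂ : Set F₂} {ψ : F₁ × F₂ → E}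

theorem mem_nhds (h : IsProductParametrization g g₁ g₂ V₁ V₂ ψ) {y : F₁ × F₂}
    (hy : y ∈ V₁ ×ˢ V₂) : V₁ ×ˢ V₂ ∈ nhds y :=
  (h.isOpen_left.prod h.isOpen_right).mem_nhds hy

theorem contDiffAt (h : IsProductParametrization g g₁ g₂ V₁ V₂ ψ) {y : F₁ × F₂}
    (hy : y ∈ V₁ ×ˢ V₂) : ContDiffAt ℝ ∞ ψ y :=
  h.smooth.contDiffAt (h.mem_nhds hy)

theorem contDiffAt_fderiv (h : IsProductParametrization g g₁ g₂ V₁ V₂ ψ) {y : F₁ × F₂}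
    (hy : y ∈ V₁ ×ˢ V₂) : ContDiffAt ℝ ∞ (fderiv ℝ ψ) y :=
  (h.contDiffAt hy).fderiv_right (by simp)

theorem contDiffAt_fderiv_fderiv (h : IsProductParametrization g g₁ g₂ V₁ V₂ ψ) {y : F₁ × F₂}
    (hy : y ∈ V₁ ×ˢ V₂) : ContDiffAt ℝ ∞ (fderiv ℝ (fderiv ℝ ψ)) y :=
  (h.contDiffAt_fderiv hy).fderiv_right (by simp)

theorem hasFDerivAt (h : IsProductParametrization g g₁ g₂ V₁ V₂ ψ) {y : F₁ × F₂}
    (hy : y ∈ V₁ ×ˢ V₂) : HasFDerivAt ψ (fderiv ℝ ψ y) y :=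
  ((h.contDiffAt hy).differentiableAt (by simp)).hasFDerivAt

theorem hasFDerivAt_fderiv (h : IsProductParametrization g g₁ g₂ V₁ V₂ ψ) {y : F₁ × F₂}
    (hy : y ∈ V₁ ×ˢ V₂) : HasFDerivAt (fderiv ℝ ψ) (fderiv ℝ (fderiv ℝ ψ) y) y :=
  ((h.contDiffAt_fderiv hy).differentiableAt (by simp)).hasFDerivAt

theorem hasFDerivAt_fderiv_fderiv (h : IsProductParametrization g g₁ g₂ V₁ V₂ ψ) {y : F₁ × F₂}
    (hy : y ∈ V₁ ×ˢ V₂) :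
    HasFDerivAt (fderiv ℝ (fderiv ℝ ψ)) (fderiv ℝ (fderiv ℝ (fderiv ℝ ψ)) y) y :=
  ((h.contDiffAt_fderiv_fderiv hy).differentiableAt (by simp)).hasFDerivAt

theorem fderiv_fderiv_comm (h : IsProductParametrization g g₁ g₂ V₁ V₂ ψ) {y : F₁ × F₂}
    (hy : y ∈ V₁ ×ˢ V₂) (a b : F₁ × F₂) :
    fderiv ℝ (fderiv ℝ ψ) y a b = fderiv ℝ (fderiv ℝ ψ) y b a :=
  (h.contDiffAt hy).isSymmSndFDerivAt (by simpa using two_le_infty) a b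

theorem third_fderiv_comm (h : IsProductParametrization g g₁ g₂ V₁ V₂ ψ) {y : F₁ × F₂}
    (hy : y ∈ V₁ ×ˢ V₂) (a b c : F₁ × F₂) :
    fderiv ℝ (fderiv ℝ (fderiv ℝ ψ)) y a b c = fderiv ℝ (fderiv ℝ (fderiv ℝ ψ)) y b a c :=
  DFunLike.congr_fun ((h.contDiffAt_fderiv hy).isSymmSndFDerivAt
    (by simpa using two_le_infty) a b) c

theorem hasFDerivAt_hessian_apply (h : IsProductParametrization g g₁ g₂ V₁ V₂ ψ) {y : F₁ × F₂}
    (hy : y ∈ V₁ ×ˢ V₂) (b c : F₁ × F₂) :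
    ∃ L : F₁ × F₂ →L[ℝ] E, HasFDerivAt (fun y => fderiv ℝ (fderiv ℝ ψ) y b c) L y ∧
      ∀ a, L a = fderiv ℝ (fderiv ℝ (fderiv ℝ ψ)) y a b c :=
  ⟨_, ((h.hasFDerivAt_fderiv_fderiv hy).clm_apply (hasFDerivAt_const b y)).clm_apply
    (hasFDerivAt_const c y), fun a => by simp⟩

theorem third_fderiv_comm_right (h : IsProductParametrization g g₁ g₂ V₁ V₂ ψ) {y : F₁ × F₂}
    (hy : y ∈ V₁ ×ˢ V₂) (a b c : F₁ × F₂) :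
    fderiv ℝ (fderiv ℝ (fderiv ℝ ψ)) y a b c = fderiv ℝ (fderiv ℝ (fderiv ℝ ψ)) y a c b := by
  obtain ⟨L, hL, hLa⟩ := h.hasFDerivAt_hessian_apply hy b c
  obtain ⟨L', hL', hLa'⟩ := h.hasFDerivAt_hessian_apply hy c b
  rw [← hLa, ← hLa']
  have he : (fun y => fderiv ℝ (fderiv ℝ ψ) y b c) =ᶠ[nhds y]
      fun y => fderiv ℝ (fderiv ℝ ψ) y c b := by
    filter_upwards [h.mem_nhds hy] with z hz using h.fderiv_fderiv_comm hz b c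
  rw [hL.unique (hL'.congr_of_eventuallyEq he)]

/-- The derivative of the isometry relation. -/
theorem fderiv_isometry (h : IsProductParametrization g g₁ g₂ V₁ V₂ ψ) (hg : IsMetric g)
    {y : F₁ × F₂} (hy : y ∈ V₁ ×ˢ V₂) (c a b : F₁ × F₂) :
    fderiv ℝ g (ψ y) (fderiv ℝ ψ y c) (fderiv ℝ ψ y a) (fderiv ℝ ψ y b) +
      g (ψ y) (fderiv ℝ (fderiv ℝ ψ) y c a) (fderiv ℝ ψ y b) +
      g (ψ y) (fderiv ℝ ψ y a) (fderiv ℝ (fderiv ℝ ψ) y c b) =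
    fderiv ℝ g₁ y.1 c.1 a.1 b.1 + fderiv ℝ g₂ y.2 c.2 a.2 b.2 := by
  have hgd : HasFDerivAt g (fderiv ℝ g (ψ y)) (ψ y) :=
    ((contDiffOn_univ.1 hg.smooth).contDiffAt.differentiableAt (by simp)).hasFDerivAt
  have hg₁ : HasFDerivAt g₁ (fderiv ℝ g₁ y.1) y.1 :=
    ((h.metric_left.smooth.contDiffAt (h.isOpen_left.mem_nhds hy.1)).differentiableAt
      (by simp)).hasFDerivAt
  have hg₂ : HasFDerivAt g₂ (fderiv ℝ g₂ y.2) y.2 :=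
    ((h.metric_right.smooth.contDiffAt (h.isOpen_right.mem_nhds hy.2)).differentiableAt
      (by simp)).hasFDerivAt
  have hl := ((hgd.comp y (h.hasFDerivAt hy)).clm_apply
    ((h.hasFDerivAt_fderiv hy).clm_apply (hasFDerivAt_const a y))).clm_apply
    ((h.hasFDerivAt_fderiv hy).clm_apply (hasFDerivAt_const b y))
  have hr := (((hg₁.comp y hasFDerivAt_fst).clm_apply (hasFDerivAt_const a.1 y)).clm_apply
    (hasFDerivAt_const b.1 y)).add
    (((hg₂.comp y hasFDerivAt_snd).clm_apply (hasFDerivAt_const a.2 y)).clm_apply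
    (hasFDerivAt_const b.2 y))
  have he : (fun y => g (ψ y) (fderiv ℝ ψ y a) (fderiv ℝ ψ y b)) =ᶠ[nhds y]
      fun y => g₁ y.1 a.1 b.1 + g₂ y.2 a.2 b.2 := by
    filter_upwards [h.mem_nhds hy] with z hz using h.isometry z hz a b
  have hu := DFunLike.congr_fun (hl.unique (hr.congr_of_eventuallyEq he)) c
  simp at hu
  linear_combination hu

/-- The derivative of the Christoffel term in the transformation law. -/
theorem hasFDerivAt_christoffel_apply (h : IsProductParametrization g g₁ g₂ V₁ V₂ ψ)
    (hΓ : Differentiable ℝ (christoffel g)) {y : F₁ × F₂} (hy : y ∈ V₁ ×ˢ V₂) (a b : F₁ × F₂) :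
    ∃ L : F₁ × F₂ →L[ℝ] E,
      HasFDerivAt (fun y => christoffel g (ψ y) (fderiv ℝ ψ y a) (fderiv ℝ ψ y b)) L y ∧
      ∀ c, L c = fderiv ℝ (christoffel g) (ψ y) (fderiv ℝ ψ y c) (fderiv ℝ ψ y a)
          (fderiv ℝ ψ y b) +
        christoffel g (ψ y) (fderiv ℝ (fderiv ℝ ψ) y c a) (fderiv ℝ ψ y b) +
        christoffel g (ψ y) (fderiv ℝ ψ y a) (fderiv ℝ (fderiv ℝ ψ) y c b) := by
  refine ⟨_, (((hΓ (ψ y)).hasFDerivAt.comp y (h.hasFDerivAt hy)).clm_apply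
    ((h.hasFDerivAt_fderiv hy).clm_apply (hasFDerivAt_const a y))).clm_apply
    ((h.hasFDerivAt_fderiv hy).clm_apply (hasFDerivAt_const b y)), fun c => ?_⟩
  simp
  abel

variable [FiniteDimensional ℝ E] [FiniteDimensional ℝ F₁] [FiniteDimensional ℝ F₂]

/-- The transformation law of the Christoffel symbols. -/
theorem fderiv_fderiv_eq (h : IsProductParametrization g g₁ g₂ V₁ V₂ ψ) (hg : IsMetric g)
    {y : F₁ × F₂} (hy : y ∈ V₁ ×ˢ V₂) (a b : F₁ × F₂) :
    fderiv ℝ (fderiv ℝ ψ) y a b =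
      fderiv ℝ ψ y (christoffel g₁ y.1 a.1 b.1, christoffel g₂ y.2 a.2 b.2) -
        christoffel g (ψ y) (fderiv ℝ ψ y a) (fderiv ℝ ψ y b) := by
  rw [← sub_eq_zero]
  refine hg.nondegenerate (ψ y) (Set.mem_univ _) _ fun w => ?_
  obtain ⟨c, rfl⟩ := h.surjective y hy w
  simp only [map_sub, sub_apply]
  rw [h.isometry y hy, metric_christoffel hg,
    metric_christoffel_of_nondegenerate (h.metric_left.nondegenerate y.1 hy.1),
    metric_christoffel_of_nondegenerate (h.metric_right.nondegenerate y.2 hy.2),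
    koszul_apply, koszul_apply, koszul_apply]
  -- The Koszul combination of the three differentiated isometry relations isolates the Hessian of
  -- `ψ`.
  have h1 := h.fderiv_isometry hg hy a b c
  have h2 := h.fderiv_isometry hg hy b a c
  have h3 := h.fderiv_isometry hg hy c a b
  rw [h.fderiv_fderiv_comm hy b a] at h2
  rw [h.fderiv_fderiv_comm hy c a, h.fderiv_fderiv_comm hy c b,
    hg.symm _ (Set.mem_univ _) (fderiv ℝ (fderiv ℝ ψ) y a c)] at h3
  rw [hg.symm _ (Set.mem_univ _) (fderiv ℝ ψ y a) (fderiv ℝ (fderiv ℝ ψ) y b c)] at h2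
  rw [hg.symm _ (Set.mem_univ _) (fderiv ℝ ψ y a) (fderiv ℝ (fderiv ℝ ψ) y b c)] at h3
  rw [hg.symm _ (Set.mem_univ _) (fderiv ℝ ψ y b) (fderiv ℝ (fderiv ℝ ψ) y a c)] at h1
  rw [hg.symm _ (Set.mem_univ _) (fderiv ℝ ψ y b) (fderiv ℝ (fderiv ℝ ψ) y a c)] at h3
  linear_combination (1 / 2) * h1 + (1 / 2) * h2 - (1 / 2) * h3

/-- The vanishing of the mixed curvature `R(a, b) a'` of a product, for `a`, `a'` tangent to the
first factor and `b` to the second one, in terms of Christoffel symbols. -/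
theorem mixed_curvature_eq_zero (h : IsProductParametrization g g₁ g₂ V₁ V₂ ψ) (hg : IsMetric g)
    (hΓ : Differentiable ℝ (christoffel g)) {y : F₁ × F₂} (hy : y ∈ V₁ ×ˢ V₂) (a a' : F₁)
    (b : F₂) : curvature g (ψ y) (fderiv ℝ ψ y (a', 0)) (fderiv ℝ ψ y (0, b))
      (fderiv ℝ ψ y (a, 0)) = 0 := by
  set Ψ := fderiv ℝ ψ
  set Γ := christoffel g (ψ y)
  -- The product metric has no mixed Christoffel symbols.
  have hmix : ∀ z ∈ V₁ ×ˢ V₂, ∀ (α : F₁) (β : F₂), fderiv ℝ Ψ z (α, 0) (0, β) =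
      -christoffel g (ψ z) (Ψ z (α, 0)) (Ψ z (0, β)) := by
    intro z hz α β
    rw [h.fderiv_fderiv_eq hg hz]
    simp only [map_zero, zero_apply, Prod.mk_zero_zero, zero_sub, Ψ]
  have h1 : fderiv ℝ (fderiv ℝ Ψ) y (a', 0) (a, 0) (0, b) =
      -(fderiv ℝ (christoffel g) (ψ y) (Ψ y (a', 0)) (Ψ y (a, 0)) (Ψ y (0, b)) +
        Γ (fderiv ℝ Ψ y (a', 0) (a, 0)) (Ψ y (0, b)) +
        Γ (Ψ y (a, 0)) (fderiv ℝ Ψ y (a', 0) (0, b))) := by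
    obtain ⟨L, hL, hLc⟩ := h.hasFDerivAt_hessian_apply hy (a, 0) (0, b)
    obtain ⟨L', hL', hLc'⟩ := h.hasFDerivAt_christoffel_apply hΓ hy (a, 0) (0, b)
    rw [← hLc, ← hLc']
    have he : (fun y => fderiv ℝ Ψ y (a, 0) (0, b)) =ᶠ[nhds y]
        fun y => -christoffel g (ψ y) (Ψ y (a, 0)) (Ψ y (0, b)) := by
      filter_upwards [h.mem_nhds hy] with z hz using hmix z hz a b
    rw [hL.unique (hL'.neg.congr_of_eventuallyEq he)]
    rfl
  set γ : F₁ := christoffel g₁ y.1 a' a with hγ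
  have h2 : fderiv ℝ (fderiv ℝ Ψ) y (0, b) (a', 0) (a, 0) = fderiv ℝ Ψ y (0, b) (γ, 0) -
      (fderiv ℝ (christoffel g) (ψ y) (Ψ y (0, b)) (Ψ y (a', 0)) (Ψ y (a, 0)) +
        Γ (fderiv ℝ Ψ y (0, b) (a', 0)) (Ψ y (a, 0)) +
        Γ (Ψ y (a', 0)) (fderiv ℝ Ψ y (0, b) (a, 0))) := by
    obtain ⟨L, hL, hLc⟩ := h.hasFDerivAt_hessian_apply hy (a', 0) (a, 0)
    obtain ⟨L', hL', hLc'⟩ := h.hasFDerivAt_christoffel_apply hΓ hy (a', 0) (a, 0)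
    have hΨ := (h.hasFDerivAt_fderiv hy).clm_apply (hasFDerivAt_const ((γ, 0) : F₁ × F₂) y)
    rw [← hLc, ← hLc']
    -- A derivative along `(0, b)` suffices: `y.1` is fixed on that line, so the first factor
    -- contributes the constant `γ`, and its Christoffel symbols need not be differentiated.
    have e1 := hL.hasLineDerivAt (0, b)
    have e2 := (hΨ.sub hL').hasLineDerivAt (0, b)
    have he : (fun t : ℝ => fderiv ℝ Ψ (y + t • (0, b)) (a', 0) (a, 0)) =ᶠ[nhds 0]
        fun t : ℝ => Ψ (y + t • (0, b)) (γ, 0) - christoffel g (ψ (y + t • (0, b)))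
          (Ψ (y + t • (0, b)) (a', 0)) (Ψ (y + t • (0, b)) (a, 0)) := by
      have hc : Filter.Tendsto (fun t : ℝ => y + t • ((0, b) : F₁ × F₂)) (nhds 0) (nhds y) := by
        have : Continuous fun t : ℝ => y + t • ((0, b) : F₁ × F₂) := by fun_prop
        simpa using this.tendsto 0
      filter_upwards [hc (h.mem_nhds hy)] with t ht
      rw [h.fderiv_fderiv_eq hg ht]
      simp [Ψ, hγ]
    have e3 := HasDerivAt.unique e1 (HasDerivAt.congr_of_eventuallyEq e2 he)
    rw [e3]
    simp [Ψ]
  -- Symmetry of the third derivative of `ψ` is the integrability condition: after substituting the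
  -- transformation law, the difference of the two sides is the mixed curvature.
  have h3 : fderiv ℝ (fderiv ℝ Ψ) y (a', 0) (a, 0) (0, b) =
      fderiv ℝ (fderiv ℝ Ψ) y (0, b) (a', 0) (a, 0) := by
    rw [h.third_fderiv_comm_right hy, h.third_fderiv_comm hy]
  rw [h1, h2] at h3
  have h4 : fderiv ℝ Ψ y (a', 0) (a, 0) = Ψ y (γ, 0) - Γ (Ψ y (a', 0)) (Ψ y (a, 0)) := by
    rw [h.fderiv_fderiv_eq hg hy]
    simp [Ψ, Γ, hγ]
  rw [h.fderiv_fderiv_comm hy (0, b), h.fderiv_fderiv_comm hy (0, b),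
    h.fderiv_fderiv_comm hy (0, b), hmix y hy, hmix y hy, hmix y hy, h4] at h3
  rw [curvature_apply, ← sub_eq_zero.2 h3.symm, fderiv_christoffel_comm hg (hΓ _) _ _ (Ψ y (0, b))]
  simp only [map_sub, map_neg, neg_apply, sub_apply]
  rw [christoffel_comm hg _ (Ψ y (0, b)) (Ψ y (a, 0)),
    christoffel_comm hg _ (Ψ y (0, b)) (christoffel g (ψ y) _ _),
    christoffel_comm hg _ (Ψ y (a, 0)) (christoffel g (ψ y) _ _)]
  abel

end IsProductParametrization

end ProductChart

end SemiRiem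
end

noncomputable section

namespace SemiRiem

/-! ### Indecomposability -/

/-- The inverse chart is used because the transformation law is written with derivatives of a map
out of the product. -/
theorem exists_isProductParametrization {E : Type*} [NormedAddCommGroup E] [NormedSpace ℝ E]
    {g : E → E →L[ℝ] E →L[ℝ] ℝ} (h : SplitsLocally g) :
    ∃ (d₁ d₂ : ℕ) (g₁ : (Fin d₁ → ℝ) → (Fin d₁ → ℝ) →L[ℝ] (Fin d₁ → ℝ) →L[ℝ] ℝ)
      (g₂ : (Fin d₂ → ℝ) → (Fin d₂ → ℝ) →L[ℝ] (Fin d₂ → ℝ) →L[ℝ] ℝ)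
      (V₁ : Set (Fin d₁ → ℝ)) (V₂ : Set (Fin d₂ → ℝ)) (ψ : (Fin d₁ → ℝ) × (Fin d₂ → ℝ) → E),
      0 < d₁ ∧ 0 < d₂ ∧ IsProductParametrization g g₁ g₂ V₁ V₂ ψ ∧ (V₁ ×ˢ V₂).Nonempty := by
  obtain ⟨d₁, d₂, V₁, V₂, g₁, g₂, φ, hd₁, hd₂, hV₁, hV₂, hg₁, hg₂, hne, ht, hφ, hψ, hiso⟩ := h
  have hφd : ∀ p ∈ φ.source, HasFDerivAt φ (fderiv ℝ φ p) p := fun p hp =>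
    ((hφ.contDiffAt (φ.open_source.mem_nhds hp)).differentiableAt (by simp)).hasFDerivAt
  have hψd : ∀ y ∈ φ.target, HasFDerivAt φ.symm (fderiv ℝ φ.symm y) y := fun y hy =>
    ((hψ.contDiffAt (φ.open_target.mem_nhds hy)).differentiableAt (by simp)).hasFDerivAt
  refine ⟨d₁, d₂, g₁, g₂, V₁, V₂, φ.symm, hd₁, hd₂, ⟨hV₁, hV₂, hg₁, hg₂, ht ▸ hψ, ?_, ?_⟩, ?_⟩
  · intro y hy a b
    rw [← ht] at hy
    have hp := φ.map_target hy
    have h1 := (hφd _ hp).comp y (hψd y hy)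
    have h2 : (φ ∘ φ.symm) =ᶠ[nhds y] id := by
      filter_upwards [φ.open_target.mem_nhds hy] with z hz using φ.right_inv hz
    have h3 : ∀ c, fderiv ℝ φ (φ.symm y) (fderiv ℝ φ.symm y c) = c := fun c =>
      DFunLike.congr_fun (h1.unique ((hasFDerivAt_id y).congr_of_eventuallyEq h2)) c
    rw [hiso _ hp, h3, h3, φ.right_inv hy]
  · intro y hy w
    rw [← ht] at hy
    have hp := φ.map_target hy
    have h1 := (hψd _ (φ.map_source hp)).comp (φ.symm y) (hφd _ hp)
    have h2 : (φ.symm ∘ φ) =ᶠ[nhds (φ.symm y)] id := by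
      filter_upwards [φ.open_source.mem_nhds hp] with z hz using φ.left_inv hz
    have h3 := DFunLike.congr_fun
      (h1.unique ((hasFDerivAt_id _).congr_of_eventuallyEq h2)) w
    rw [φ.right_inv hy] at h3
    exact ⟨_, h3⟩
  · obtain ⟨p, hp⟩ := hne
    exact ⟨φ p, ht ▸ φ.map_source hp⟩

variable {ι : Type*} [Fintype ι]

theorem horizontal_eq_of_vertLift_eq [DecidableEq ι] {M : Matrix ι ι ℂ} (hM : IsUnit M)
    {x y : ι ⊕ ι → ℂ} {c d : ℂ} (h : c • vertLift M x = d • vertLift M y) (a : ι) :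
    conj c * x (Sum.inl a) = conj d * y (Sum.inl a) := by
  have h1 : M *ᵥ (conj c • fun a => x (Sum.inl a)) = M *ᵥ (conj d • fun a => y (Sum.inl a)) := by
    ext b
    have h2 := congrArg conj (congrFun h (Sum.inr b))
    simp only [Pi.smul_apply, smul_eq_mul, map_mul, vertLift_inr, Complex.conj_conj] at h2
    rw [Matrix.mulVec_smul, Matrix.mulVec_smul]
    exact h2
  have h3 := Matrix.mulVec_injective_iff_isUnit.2 hM h1
  exact congrFun h3 a

theorem exists_horForm_ne_zero [DecidableEq ι] {M : Matrix ι ι ℂ} (hM : IsUnit M)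
    {x : ι ⊕ ι → ℂ} {a : ι} (hx : x (Sum.inl a) ≠ 0) : ∃ v, horForm M x v ≠ 0 := by
  by_contra! h
  have h1 : (M *ᵥ fun a => x (Sum.inl a)) = M *ᵥ 0 := by
    ext b
    have h2 := h (Pi.single (Sum.inl b) 1)
    simpa [horForm_apply, dotProduct, Pi.single_apply] using h2
  exact hx (congrFun (Matrix.mulVec_injective_iff_isUnit.2 hM h1) a)

/-- If the horizontal parts of two families of vectors span and satisfy the relation given by the
vanishing of the mixed curvature, then one of the families is vertical. -/
theorem horizontal_eq_zero_of_mixed [DecidableEq ι] [Nontrivial ι] {M : Matrix ι ι ℂ}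
    (hMs : Mᵀ = M) (hM : IsUnit M) {A C : Set (ι ⊕ ι → ℂ)}
    (hspan : ∀ w, ∃ a ∈ A, ∃ c ∈ C, w = a + c)
    (hmix : ∀ a ∈ A, ∀ a' ∈ A, ∀ c ∈ C,
      horForm M a c • vertLift M a' = horForm M a' a • vertLift M c) :
    (∀ a ∈ A, ∀ i, a (Sum.inl i) = 0) ∨ ∀ c ∈ C, ∀ i, c (Sum.inl i) = 0 := by
  by_contra! hcon
  obtain ⟨⟨a₀, ha₀, i, hi⟩, c₀, hc₀, j, hj⟩ := hcon
  have hl := fun a ha a' ha' c hc => horizontal_eq_of_vertLift_eq hM (hmix a ha a' ha' c hc)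
  -- If `H` vanishes on `A`, the relation makes `a₀` orthogonal to `C` too, hence to everything,
  -- against invertibility of `M`.
  by_cases hA : ∀ a ∈ A, ∀ a' ∈ A, horForm M a a' = 0
  · have hAC : ∀ c ∈ C, horForm M a₀ c = 0 := by
      intro c hc
      have h1 := hl a₀ ha₀ a₀ ha₀ c hc i
      rw [hA a₀ ha₀ a₀ ha₀, map_zero, zero_mul] at h1
      simpa using (mul_eq_zero.1 h1).resolve_right hi
    obtain ⟨v, hv⟩ := exists_horForm_ne_zero hM hi
    obtain ⟨a, ha, c, hc, rfl⟩ := hspan v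
    rw [map_add, hA a₀ ha₀ a ha, hAC c hc, add_zero] at hv
    exact hv rfl
  · push Not at hA
    obtain ⟨a', ha', a, ha, haa⟩ := hA
    -- Otherwise `C` is horizontally on the line of `a'`, and then `A` on the line of `c₀`. The
    -- whole horizontal space would be one complex line, impossible since `ι` has two elements.
    have hca : ∀ c ∈ C, ∃ r : ℂ, ∀ k, c (Sum.inl k) = r * a' (Sum.inl k) := by
      intro c hc
      refine ⟨conj (horForm M a c) / conj (horForm M a' a), fun k => ?_⟩
      have h1 := hl a ha a' ha' c hc k
      have h2 : conj (horForm M a' a) ≠ 0 := by simpa using haa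
      field_simp
      linear_combination -h1
    have hac : ∀ b ∈ A, ∃ r : ℂ, ∀ k, b (Sum.inl k) = r * c₀ (Sum.inl k) := by
      intro b hb
      obtain ⟨r, hr⟩ := hca c₀ hc₀
      have hr0 : r ≠ 0 := by
        rintro rfl
        exact hj (by rw [hr, zero_mul])
      have hac₀ : horForm M a c₀ = r * horForm M a' a := by
        rw [horForm_comm hMs a' a]
        simp only [horForm_apply, dotProduct, hr, Finset.mul_sum]
        exact Finset.sum_congr rfl fun k _ => by ring
      have h2 : conj (horForm M a c₀) ≠ 0 := by
        simpa [hac₀] using ⟨hr0, haa⟩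
      refine ⟨conj (horForm M b a) / conj (horForm M a c₀), fun k => ?_⟩
      have h1 := hl a ha b hb c₀ hc₀ k
      field_simp
      linear_combination h1
    obtain ⟨r', hr'⟩ := hac a' ha'
    have hall : ∀ w : ι ⊕ ι → ℂ, ∃ r : ℂ, ∀ k, w (Sum.inl k) = r * c₀ (Sum.inl k) := by
      intro w
      obtain ⟨b, hb, c, hc, rfl⟩ := hspan w
      obtain ⟨r, hr⟩ := hac b hb
      obtain ⟨s, hs⟩ := hca c hc
      exact ⟨r + s * r', fun k => by rw [Pi.add_apply, hr, hs, hr']; ring⟩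
    -- The basis vector at `k ≠ j` is off the line of `c₀`, whose entry at `j` is nonzero.
    obtain ⟨k, hk⟩ := exists_ne j
    obtain ⟨r, hr⟩ := hall (Pi.single (Sum.inl k) 1)
    have h1 := hr j
    have h2 := hr k
    rw [Pi.single_eq_of_ne (by simpa using hk.symm)] at h1
    rw [(mul_eq_zero.1 h1.symm).resolve_right hj, Pi.single_eq_same, zero_mul] at h2
    exact one_ne_zero h2

namespace IsQuarticMetric

variable {M : Matrix ι ι ℂ} {g : (ι ⊕ ι → ℂ) → (ι ⊕ ι → ℂ) →L[ℝ] (ι ⊕ ι → ℂ) →L[ℝ] ℝ}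

theorem apply_eq_zero_of_vertical (hg : IsQuarticMetric M g) (p : ι ⊕ ι → ℂ) {v w : ι ⊕ ι → ℂ}
    (hv : ∀ i, v (Sum.inl i) = 0) (hw : ∀ i, w (Sum.inl i) = 0) : g p v w = 0 := by
  rw [hg.apply_eq, quarticMetric_vert _ _ _ _ hv]
  simp [hw]

/-- One factor would be tangent to vertical vectors, on which `g` vanishes, while its own metric is
non-degenerate in positive dimension. -/
theorem isIndecomposable [DecidableEq ι] [Nontrivial ι] (hg : IsQuarticMetric M g)
    (hM : IsUnit M) : IsIndecomposable g := by
  intro hs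
  obtain ⟨d₁, d₂, g₁, g₂, V₁, V₂, ψ, hd₁, hd₂, h, y, hy⟩ := exists_isProductParametrization hs
  have := Fin.pos_iff_nonempty.1 hd₁
  have := Fin.pos_iff_nonempty.1 hd₂
  have hmix := h.mixed_curvature_eq_zero hg.isMetric
    ((hg.contDiff_christoffel (m := 1)).differentiable (by simp)) hy
  rcases horizontal_eq_zero_of_mixed hg.transpose_eq hM
    (A := Set.range fun a => fderiv ℝ ψ y (a, 0)) (C := Set.range fun b => fderiv ℝ ψ y (0, b))
    (by
      intro w
      obtain ⟨c, rfl⟩ := h.surjective y hy w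
      refine ⟨_, ⟨c.1, rfl⟩, _, ⟨c.2, rfl⟩, ?_⟩
      rw [← map_add]
      simp)
    (by
      rintro _ ⟨a, rfl⟩ _ ⟨a', rfl⟩ _ ⟨b, rfl⟩
      have h1 := hmix a a' b
      rw [hg.curvature_apply, sub_eq_zero, horForm_comm hg.transpose_eq] at h1
      exact h1) with h0 | h0
  · obtain ⟨a, ha⟩ := exists_ne (0 : Fin d₁ → ℝ)
    refine ha (h.metric_left.nondegenerate y.1 hy.1 a fun b => ?_)
    have h1 := h.isometry y hy (a, 0) (b, 0)
    rw [hg.apply_eq_zero_of_vertical _ (h0 _ ⟨a, rfl⟩) (h0 _ ⟨b, rfl⟩)] at h1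
    simpa using h1.symm
  · obtain ⟨a, ha⟩ := exists_ne (0 : Fin d₂ → ℝ)
    refine ha (h.metric_right.nondegenerate y.2 hy.2 a fun b => ?_)
    have h1 := h.isometry y hy (0, a) (0, b)
    rw [hg.apply_eq_zero_of_vertical _ (h0 _ ⟨a, rfl⟩) (h0 _ ⟨b, rfl⟩)] at h1
    simpa using h1.symm

end IsQuarticMetric

/-! ### Specialisation to `σ` and the zero-dimensional case -/

theorem isQuarticMetric_metric {n : ℕ} (σ : Matrix (Fin n) (Fin n) ℂ) :
    IsQuarticMetric (sigmaMatrix σ) (metric σ) :=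
  ⟨sigmaMatrix_transpose σ, metric_eq σ⟩

theorem sigmaMatrix_ne_zero {n : ℕ} {σ : Matrix (Fin n) (Fin n) ℂ} (hσ : σ ≠ 0) :
    sigmaMatrix σ ≠ 0 := by
  intro h
  refine hσ (Matrix.ext fun i j => ?_)
  exact congrFun (congrFun h (Sum.inl i)) (Sum.inr j)

theorem isUnit_sigmaMatrix {n : ℕ} {σ : Matrix (Fin n) (Fin n) ℂ} (hσ : σ.det ≠ 0) :
    IsUnit (sigmaMatrix σ) := by
  have h1 : IsUnit σ.det := isUnit_iff_ne_zero.2 hσ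
  have h2 : IsUnit σᵀ.det := by rwa [Matrix.det_transpose]
  refine IsUnit.of_mul_eq_one (Matrix.fromBlocks 0 σᵀ⁻¹ σ⁻¹ 0) ?_
  rw [sigmaMatrix, Matrix.fromBlocks_multiply]
  simp [Matrix.mul_nonsing_inv _ h1, Matrix.mul_nonsing_inv _ h2]

theorem not_splitsLocally_of_subsingleton {E : Type*} [NormedAddCommGroup E] [NormedSpace ℝ E]
    [Subsingleton E] (g : E → E →L[ℝ] E →L[ℝ] ℝ) : IsIndecomposable g := by
  intro hs
  obtain ⟨d₁, d₂, g₁, g₂, V₁, V₂, ψ, hd₁, -, h, y, hy⟩ := exists_isProductParametrization hs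
  have := Fin.pos_iff_nonempty.1 hd₁
  obtain ⟨a, ha⟩ := exists_ne (0 : Fin d₁ → ℝ)
  refine ha (h.metric_left.nondegenerate y.1 hy.1 a fun b => ?_)
  have h1 := h.isometry y hy (a, 0) (b, 0)
  rw [Subsingleton.elim (fderiv ℝ ψ y (a, 0)) 0] at h1
  simpa using h1.symm

theorem isHolonomyIndecomposableAt_of_subsingleton {E : Type*} [NormedAddCommGroup E]
    [NormedSpace ℝ E] [Subsingleton E] (g : E → E →L[ℝ] E →L[ℝ] ℝ) (p : E) :
    IsHolonomyIndecomposableAt g p := by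
  rintro ⟨W, -, h⟩
  exact (h 0).1 (Subsingleton.elim _ _)

end SemiRiem
end

theorem proposition2p2 (n : ℕ) (σ : Matrix (Fin n) (Fin n) ℂ) (hσ : σ.IsSymm) :
    SemiRiem.IsPseudoKahler (SemiRiem.metric σ) ∧
    SemiRiem.HasSignature (SemiRiem.metric σ) (4 * n) (4 * n) ∧
    SemiRiem.IsLocallySymmetric (SemiRiem.metric σ) ∧
    SemiRiem.IsRicciFlat (SemiRiem.metric σ) ∧
    SemiRiem.IsGeodesicallyComplete (SemiRiem.metric σ) ∧
    SemiRiem.IsSymmetricSpace (SemiRiem.metric σ) ∧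
    SemiRiem.IsHermitianSymmetricSpace (SemiRiem.metric σ) ∧
    (σ ≠ 0 →
      ¬ SemiRiem.IsFlat (SemiRiem.metric σ) ∧
      ¬ SemiRiem.IsConformallyFlat (SemiRiem.metric σ)) ∧
    (σ.det ≠ 0 →
      SemiRiem.IsIndecomposable (SemiRiem.metric σ) ∧
      ∀ p : SemiRiem.Idx n → ℂ,
        SemiRiem.IsHolonomyIndecomposableAt (SemiRiem.metric σ) p ∧
        ∀ A : (SemiRiem.Idx n → ℂ) →L[ℝ] (SemiRiem.Idx n → ℂ),
          A ∈ SemiRiem.holonomyAlgebra (SemiRiem.metric σ) p ↔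
            ∃ B : Matrix (SemiRiem.HalfIdx n) (SemiRiem.HalfIdx n) ℂ,
              Bᴴ = -B ∧
              ∀ v, A v = (Matrix.fromBlocks 0 0 B 0 :
                Matrix (SemiRiem.Idx n) (SemiRiem.Idx n) ℂ) *ᵥ v) := by
  have hg := SemiRiem.isQuarticMetric_metric σ
  have hsig : 4 * n = 2 * Fintype.card (SemiRiem.HalfIdx n) := by
    rw [Fintype.card_sum, Fintype.card_fin]; omega
  refine ⟨hg.isPseudoKahler, hsig ▸ hg.hasSignature, hg.isLocallySymmetric, hg.isRicciFlat,
    hg.isGeodesicallyComplete, hg.isSymmetricSpace, hg.isHermitianSymmetricSpace,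
    fun h => ⟨hg.not_isFlat (SemiRiem.sigmaMatrix_ne_zero h),
      hg.not_isConformallyFlat (SemiRiem.sigmaMatrix_ne_zero h)⟩, fun h => ?_⟩
  have hM := SemiRiem.isUnit_sigmaMatrix h
  -- The indecomposability arguments need two horizontal coordinates. For `n = 0` the determinant is
  -- `1` and the tangent space is zero, so nothing can split off; for `n > 0` there are `2n ≥ 2` of
  -- them.
  rcases Nat.eq_zero_or_pos n with rfl | hn
  · exact ⟨SemiRiem.not_splitsLocally_of_subsingleton _, fun p =>
      ⟨SemiRiem.isHolonomyIndecomposableAt_of_subsingleton _ p, hg.mem_holonomyAlgebra_iff hM p⟩⟩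
  · have : Nontrivial (SemiRiem.HalfIdx n) :=
      ⟨Sum.inl ⟨0, hn⟩, Sum.inr ⟨0, hn⟩, by simp⟩
    exact ⟨hg.isIndecomposable hM, fun p =>
      ⟨hg.isHolonomyIndecomposableAt hM p, hg.mem_holonomyAlgebra_iff hM p⟩⟩
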